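/- Let $\mathscr T=\,]0,\infty[\times\mathbb R$ with points $(t,x)$, and let $\mathscr H=\frac12\left(-\frac{\partial^2}{\partial x^2}+x^2\right)$ be the Hamiltonian of the quantum harmonic oscillator on $\mathbb R$. A function $Y$ on $\mathbb R$ is said to evolve to a distribution $\varphi\in\mathscr D'(\mathscr T,\mathbb C)$ if there is a family $u(t)\in\mathscr S'(\mathbb R)$, $t\ge 0$, with $u(0)=Y$, such that for every $f\in\mathscr S(\mathbb R)$ the function $t\mapsto\langle u(t),f\rangle$ is differentiable on $[0,\infty[$ with $i\frac{d}{dt}\langle u(t),f\rangle=\langle\mathscr H u(t),f\rangle$, and such that $\langle\varphi,\theta\rangle=\int_0^\infty\langle u(t),\theta(t,\cdot)\rangle\,dt$ for every test function $\theta\in\mathscr D(\mathscr T)$, the integrand being integrable. A sequence $(\psi_N)_{N\ge1}$ of complex functions on a space $X$ is called a supershift for a family $\mathscr F=\{\varphi_\lambda\,;\,\lambda\in\mathbb R\}$ of complex functions on $X$, with supershift domain the open set $D\subseteq X$, if each $\psi_N$ has the form $\sum_{j=0}^N C_j(N)\varphi_{k_j(N)}$ with $C_j(N)\in\mathbb C$,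 $k_j(N)\in\mathbb R$, $|k_j(N)|\le1$, and $\psi_N$ converges locally uniformly on $D$ to a finite complex linear combination of functions $\varphi_{\nu k(\infty)}$, $\nu\in\mathbb Z\setminus\{0\}$, for some $k(\infty)\in\mathbb R\setminus[-1,1]$. Proposition. (1) For every $\lambda\in\mathbb R$ the datum $x\mapsto e^{i\lambda x}$ evolves to exactly one distribution $\varphi_\lambda\in\mathscr D'(\mathscr T,\mathbb C)$, and the singular support of $\varphi_\lambda$ is $\{(t,x): t=(2k+1)\pi/2 \text{ for some } k\in\mathbb N\}$. (2) Let $\mathscr U=\mathscr T\setminus\{(t,x): t=(2k+1)\pi/2,\ k\in\mathbb N\}$. The restrictions $(\varphi_\lambda)_{|\mathscr U}$ are $C^\infty$ functions on $\mathscr U$. For every $a\in\mathbb R\setminus[-1,1]$, the sequence of functions on $\mathscr U$ $$\psi_N(\cdot,a)=\sum_{j=0}^N C_j(N,a)\,(\varphi_{1-2j/N})_{|\mathscr U},\qquad C_j(N,a)=\binom Nj\Big(\frac{1+a}2\Big)^{N-j}\Big(\frac{1-a}2\Big)^j\qquad(N\ge1),$$ is a supershift for $\{(\varphi_\lambda)_{|\mathscr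 U}\,;\,\lambda\in\mathbb R\}$ with supershift domain $\mathscr U$. (3) Moreover, for all $\mu,\nu\in\mathbb N$, each $\psi=\psi_N(\cdot,a)$ $(N\ge1)$ and $\psi=(\varphi_a)_{|\mathscr U}$ satisfy on $\mathscr U$ $$\frac{\partial^{\mu+\nu}\psi}{\partial t^\mu\partial x^\nu}=\frac1{(2i)^\mu}\,\frac{\partial^\nu}{\partial x^\nu}\Big(-\frac{\partial^2}{\partial x^2}+x^2\Big)^{\mu}\psi ,$$ and, uniformly on every compact $K\subset\mathscr U$ as $N\to\infty$, $$\frac{\partial^{\mu+\nu}}{\partial t^\mu\partial x^\nu}\psi_N(\cdot,a)\longrightarrow\frac{\partial^{\mu+\nu}}{\partial t^\mu\partial x^\nu}\varphi_a,\qquad \frac1{(2i)^\mu}\Big(-\frac{\partial^2}{\partial x^2}+x^2\Big)^{\mu}\frac{\partial^\nu}{\partial x^\nu}\psi_N(\cdot,a)\longrightarrow\frac1{(2i)^\mu}\Big(-\frac{\partial^2}{\partial x^2}+x^2\Big)^{\mu}\frac{\partial^\nu}{\partial x^\nu}\varphi_a .$$ -/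

import Mathlib

open scoped Distributions SchwartzMap ContDiff

noncomputable section

namespace OscillatorSupershift

/-! ### Phase space -/

/-- The open phase space `]0,∞[ × ℝ`, with points `(t, x)`. -/
def phaseSpace : TopologicalSpace.Opens (ℝ × ℝ) :=
  ⟨{p | 0 < p.1}, isOpen_lt continuous_const continuous_fst⟩

/-- The lines `t = (2k+1)π/2`, `k ∈ ℕ`. -/
def singularLines : Set (ℝ × ℝ) :=
  {p | ∃ k : ℕ, p.1 = Real.pi * (2 * (k : ℝ) + 1) / 2}

/-- The complement in `]0,∞[ × ℝ` of the lines `t = (2k+1)π/2`, `k ∈ ℕ`. -/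
def regularRegion : Set (ℝ × ℝ) := (phaseSpace : Set (ℝ × ℝ)) \ singularLines

/-! ### Distributions given by functions, and singular supports -/

/-- On the open set `V`, the distribution `φ` is given by the function `g`. (It is used only for
`g` smooth on `V`, so that the integrand is continuous with compact support.) -/
def IsGivenOnBy {Ω : TopologicalSpace.Opens (ℝ × ℝ)} (φ : 𝓓'(Ω, ℂ)) (V : Set (ℝ × ℝ))
    (g : ℝ × ℝ → ℂ) : Prop :=
  ∀ θ : 𝓓(Ω, ℝ), tsupport θ ⊆ V → φ θ = ∫ p : ℝ × ℝ, (θ p : ℂ) * g p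

/-- The singular support: the points of `Ω` without any open neighbourhood on which the
distribution is a `C^∞` function. -/
def singularSupport {Ω : TopologicalSpace.Opens (ℝ × ℝ)} (φ : 𝓓'(Ω, ℂ)) : Set (ℝ × ℝ) :=
  {p | p ∈ Ω ∧ ¬ ∃ V : Set (ℝ × ℝ), IsOpen V ∧ p ∈ V ∧ V ⊆ Ω ∧
    ∃ g : ℝ × ℝ → ℂ, ContDiffOn ℝ ∞ g V ∧ IsGivenOnBy φ V g}

/-! ### The Cauchy problem for the quantum harmonic oscillator -/

/-- The Hamiltonian `T ↦ (- d²T/dx² + x² T) / 2` on tempered distributions on `ℝ`. -/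
def hamiltonian (T : 𝓢'(ℝ, ℂ)) : 𝓢'(ℝ, ℂ) :=
  (1 / 2 : ℂ) •
    (-(TemperedDistribution.derivCLM ℂ (TemperedDistribution.derivCLM ℂ T)) +
      TemperedDistribution.smulLeftCLM ℂ (fun x : ℝ => (x : ℂ) ^ 2) T)

/-- `u` is a solution on `[0,∞[` of `i ∂u/∂t = ℋ u`, `u(0) = Y`, with values in the tempered
distributions on `ℝ` (the derivative is the one of the weak topology, one-sided at `t = 0`). -/
def SolvesCauchyProblem (Y : ℝ → ℂ) (u : ℝ → 𝓢'(ℝ, ℂ)) : Prop :=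
  (∀ f : 𝓢(ℝ, ℂ), u 0 f = ∫ x : ℝ, Y x * f x) ∧
  ∀ f : 𝓢(ℝ, ℂ), ∀ t : ℝ, 0 ≤ t → ∃ d : ℂ,
    HasDerivWithinAt (fun s : ℝ => u s f) d (Set.Ici 0) t ∧
      Complex.I * d = hamiltonian (u t) f

/-- The slice `x ↦ θ(t, x)` of a test function, as a Schwartz function. -/
def timeSlice {Ω : TopologicalSpace.Opens (ℝ × ℝ)} (θ : 𝓓(Ω, ℝ)) (t : ℝ) : 𝓢(ℝ, ℂ) :=
  HasCompactSupport.toSchwartzMap (f := fun x : ℝ => ((θ (t, x) : ℝ) : ℂ))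
    (by
      have h := (θ.hasCompactSupport.comp_isClosedEmbedding
        (Topology.IsClosedEmbedding.of_continuous_injective_isClosedMap
          (f := fun x : ℝ => (t, x)) (by fun_prop) (fun x y h => (Prod.ext_iff.1 h).2)
          (by
            intro s hs
            have : (fun x : ℝ => (t, x)) '' s = ({t} : Set ℝ) ×ˢ s := by
              ext ⟨a, b⟩; simp [eq_comm, and_comm]
            rw [this]; exact isClosed_singleton.prod hs)))
      exact h.comp_left Complex.ofReal_zero)
    (Complex.ofRealCLM.contDiff.comp
      (θ.contDiff.comp (contDiff_const.prodMk contDiff_id)))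

/-- The datum `Y` evolves through the Schrödinger equation to the distribution `φ` on
`]0,∞[ × ℝ`: there is a solution `u` of the Cauchy problem such that
`⟨φ, θ⟩ = ∫_0^∞ ⟨u(t), θ(t, ·)⟩ dt` for each test function `θ`. -/
def EvolvesTo (Y : ℝ → ℂ) (φ : 𝓓'(phaseSpace, ℂ)) : Prop :=
  ∃ u : ℝ → 𝓢'(ℝ, ℂ), SolvesCauchyProblem Y u ∧
    ∀ θ : 𝓓(phaseSpace, ℝ),
      MeasureTheory.IntegrableOn (fun t : ℝ => u t (timeSlice θ t)) (Set.Ioi 0) ∧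
      φ θ = ∫ t in Set.Ioi (0 : ℝ), u t (timeSlice θ t)

/-- The character `x ↦ e^{iλx}`. -/
def character (lam : ℝ) : ℝ → ℂ := fun x => Complex.exp (Complex.I * lam * x)

/-! ### Supershifts -/

/-- The sequence `(ψ_N)_{N ≥ 1}` is a supershift for the family `F = {φ_λ ; λ ∈ ℝ}` of functions
on `X`, with supershift domain `D`. -/
def IsSupershift {X : Type*} [TopologicalSpace X] (F : ℝ → X → ℂ) (ψ : ℕ → X → ℂ)
    (D : Set X) : Prop :=
  (∃ (C : ℕ → ℕ → ℂ) (k : ℕ → ℕ → ℝ), ∀ N : ℕ, 1 ≤ N →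
    (∀ j ≤ N, |k N j| ≤ 1) ∧
      ∀ τ : X, ψ N τ = ∑ j ∈ Finset.range (N + 1), C N j * F (k N j) τ) ∧
  IsOpen D ∧
  ∃ kinf : ℝ, kinf ∉ Set.Icc (-1 : ℝ) 1 ∧
    ∃ (S : Finset ℤ) (c : ℤ → ℂ), (0 : ℤ) ∉ S ∧
      TendstoLocallyUniformlyOn ψ (fun τ => ∑ ν ∈ S, c ν * F ((ν : ℝ) * kinf) τ)
        Filter.atTop D

/-- `C_j(N,a) = binom(N,j) ((1+a)/2)^(N-j) ((1-a)/2)^j`. -/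
def coeffC (N j : ℕ) (a : ℝ) : ℝ :=
  (N.choose j : ℝ) * ((1 + a) / 2) ^ (N - j) * ((1 - a) / 2) ^ j

/-- `ψ_N(·,a) = ∑_{j=0}^N C_j(N,a) φ_{1-2j/N}`. -/
def shiftSeq (Φ : ℝ → ℝ × ℝ → ℂ) (a : ℝ) (N : ℕ) : ℝ × ℝ → ℂ := fun p =>
  ∑ j ∈ Finset.range (N + 1), (coeffC N j a : ℂ) * Φ (1 - 2 * (j : ℝ) / (N : ℝ)) p

/-! ### Differential operators on functions of `(t, x)` -/

/-- `∂/∂t`. -/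
def dt (f : ℝ × ℝ → ℂ) : ℝ × ℝ → ℂ := fun p => deriv (fun s : ℝ => f (s, p.2)) p.1

/-- `∂/∂x`. -/
def dx (f : ℝ × ℝ → ℂ) : ℝ × ℝ → ℂ := fun p => deriv (fun y : ℝ => f (p.1, y)) p.2

/-- `- ∂²/∂x² + x²`. -/
def oscOp (f : ℝ × ℝ → ℂ) : ℝ × ℝ → ℂ := fun p => -(dx (dx f) p) + (p.2 : ℂ) ^ 2 * f p

end OscillatorSupershift

end

/-!
For `e^{iλx}` the harmonic oscillator is solved by the explicit wave
`ψ_λ(t, x) = |cos t|^(-1/2) exp(-iπm(t)/2 - i (x² + λ²) tan t / 2 + iλx / cos t)`,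
where the Maslov index `m(t)` counts the caustics `cos t = 0` crossed up to the time `t`.

*Existence.* Off the caustics the wave is smooth and satisfies `i ∂ψ/∂t = ℋψ`, so that its pairing
with a Schwartz function is differentiable, by dominated convergence and integration by parts.
At a caustic the state is a point mass at `± λ`. Rewriting the pairing as a Gaussian integral
against the Fourier transform (Parseval for Fresnel integrals,
`integral_fresnel_mul_fourier`) shows that the pairing is continuous there; the equation then holds
at the caustic too, because the derivative has a limit (`hasDerivAt_evolution`).

*Uniqueness.* On the functions `x^k e^{-x²/2}` the Hamiltonian is triangular with respect to `k`,
so the Cauchy problem reduces to a triangular system of ordinary differential equations, and two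
solutions agree on these functions. Their span is dense: if `h` is a test function, the Taylor
polynomials of its Fourier transform, multiplied by `e^{-x²/2}`, converge in the Schwartz space;
and every test function is `e^{-x²/2}` times the Fourier transform of a Schwartz function, which is
a limit of test functions (`eq_zero_of_apply_hermiteMonomial`).

*Singular support.* The modulus `|cos t|^(-1/2)` of the wave is locally integrable, so the
distribution is a function, smooth off the caustics and unbounded near each point of them.

*Supershift.* At fixed `(t, x)` the sequence `ψ_N(·, a)` is the Bernstein polynomial at `a` of the
entire function `λ ↦ ψ_λ(t, x)`. For an entire function the Bernstein polynomials converge at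
every real point, even outside `[-1, 1]`: the normalized moments of the signed binomial weights are
bounded by a geometric sequence and tend to the powers of `(1 - a) / 2`
(`tendstoUniformlyOn_bernstein`). Every derivative of the wave is the wave times a polynomial in `λ`
with smooth coefficients (`IsWaveFamily`), again entire in `λ` and locally bounded, so the same
convergence holds for all derivatives, uniformly on compact sets.
-/

noncomputable section

namespace OscillatorSupershift

/-! ### Bernstein operators at a point outside the interval -/

/-- The `n`-th moment `∑ j, C_j(N,a) j^n` of the (signed) binomial weights. -/
def binomialMoment (N n : ℕ) (a : ℝ) : ℝ :=
  ∑ j ∈ Finset.range (N + 1), coeffC N j a * (j : ℝ) ^ n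

lemma binomialMoment_zero_right (N : ℕ) (a : ℝ) : binomialMoment N 0 a = 1 := by
  have h := add_pow ((1 - a) / 2) ((1 + a) / 2) N
  have h1 : (1 - a) / 2 + (1 + a) / 2 = 1 := by ring
  rw [h1, one_pow] at h
  rw [binomialMoment, h]
  refine Finset.sum_congr rfl fun j _ => ?_
  simp only [coeffC]
  ring

lemma binomialMoment_zero_succ (n : ℕ) (a : ℝ) : binomialMoment 0 (n + 1) a = 0 := by
  simp [binomialMoment]

/-- A recursion for the moments, from `(j + 1) binom(N+1, j+1) = (N + 1) binom(N, j)` and the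
binomial expansion of `(j + 1)^n`. -/
lemma binomialMoment_succ_succ (N n : ℕ) (a : ℝ) :
    binomialMoment (N + 1) (n + 1) a =
      (N + 1) * ((1 - a) / 2) *
        ∑ i ∈ Finset.range (n + 1), (n.choose i : ℝ) * binomialMoment N i a := by
  have hL : binomialMoment (N + 1) (n + 1) a = (N + 1) * ((1 - a) / 2) *
      ∑ j ∈ Finset.range (N + 1), coeffC N j a * ((j : ℝ) + 1) ^ n := by
    rw [binomialMoment, Finset.sum_range_succ', Finset.mul_sum]
    simp only [Nat.cast_zero, ne_eq, Nat.add_eq_zero_iff, one_ne_zero, and_false,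
      not_false_eq_true, zero_pow, mul_zero, add_zero]
    refine Finset.sum_congr rfl fun j _ => ?_
    have h : ((N : ℝ) + 1) * (N.choose j : ℝ) = ((N + 1).choose (j + 1) : ℝ) * (j + 1) := by
      exact_mod_cast Nat.add_one_mul_choose_eq N j
    simp only [coeffC, Nat.add_sub_add_right, Nat.cast_add, Nat.cast_one]
    linear_combination (-((1 + a) / 2) ^ (N - j) * ((1 - a) / 2) ^ (j + 1) * ((j : ℝ) + 1) ^ n) * h
  rw [hL]
  congr 1
  simp only [binomialMoment, Finset.mul_sum]
  rw [Finset.sum_comm]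
  refine Finset.sum_congr rfl fun j _ => ?_
  rw [add_pow, Finset.mul_sum]
  refine Finset.sum_congr rfl fun i _ => ?_
  simp only [one_pow]
  ring

/-- The moments grow like those of a point mass at `N B`, although the weights have both signs and
the sum of their absolute values is exponential in `N` when `|a| > 1`. -/
lemma abs_binomialMoment_le {a B : ℝ} (hB : 1 ≤ B) (ha : |(1 - a) / 2| ≤ B) (n N : ℕ) :
    |binomialMoment N n a| ≤ (N * B) ^ n := by
  induction n using Nat.strong_induction_on generalizing N with
  | _ n ih =>
    rcases n with _ | n
    · simp [binomialMoment_zero_right]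
    rcases N with _ | N
    · simp [binomialMoment_zero_succ]
    have hB0 : 0 ≤ B := by linarith
    have hsum : |∑ i ∈ Finset.range (n + 1), (n.choose i : ℝ) * binomialMoment N i a| ≤
        (N * B + 1) ^ n := by
      refine (Finset.abs_sum_le_sum_abs _ _).trans ?_
      rw [add_pow]
      refine Finset.sum_le_sum fun i hi => ?_
      rw [abs_mul, Nat.abs_cast, one_pow, mul_one, mul_comm]
      exact mul_le_mul_of_nonneg_right (ih i (by simpa using hi) N) (by positivity)
    have h2 : (N * B + 1) ^ n ≤ (((N + 1 : ℕ) : ℝ) * B) ^ n := by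
      refine pow_le_pow_left₀ (by positivity) ?_ n
      push_cast
      linarith
    rw [binomialMoment_succ_succ, abs_mul, abs_mul, pow_succ']
    push_cast at h2 ⊢
    have h3 : |(N : ℝ) + 1| = N + 1 := abs_of_nonneg (by positivity)
    rw [h3]
    gcongr
    exact hsum.trans h2

lemma tendsto_binomialMoment (a : ℝ) (n : ℕ) :
    Filter.Tendsto (fun N : ℕ => binomialMoment N n a / (N : ℝ) ^ n) Filter.atTop
      (nhds (((1 - a) / 2) ^ n)) := by
  induction n using Nat.strong_induction_on with
  | _ n ih =>
    rcases n with _ | n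
    · simp [binomialMoment_zero_right]
    rw [← Filter.tendsto_add_atTop_iff_nat 1]
    have hterm : ∀ i ∈ Finset.range (n + 1), Filter.Tendsto
        (fun N : ℕ => (n.choose i : ℝ) * (binomialMoment N i a / (N : ℝ) ^ i *
          ((N : ℝ) / (N + 1)) ^ i * (1 / ((N : ℝ) + 1)) ^ (n - i))) Filter.atTop
        (nhds ((n.choose i : ℝ) * (((1 - a) / 2) ^ i * 1 ^ i * 0 ^ (n - i)))) := by
      intro i hi
      exact (((ih i (by simpa using hi)).mul
        ((tendsto_natCast_div_add_atTop (1 : ℝ)).pow i)).mul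
        (tendsto_one_div_add_atTop_nhds_zero_nat.pow (n - i))).const_mul _
    have hsum := (tendsto_finsetSum _ hterm).const_mul ((1 - a) / 2)
    have hval : (1 - a) / 2 * ∑ i ∈ Finset.range (n + 1),
        ((n.choose i : ℝ) * (((1 - a) / 2) ^ i * 1 ^ i * 0 ^ (n - i))) =
        ((1 - a) / 2) ^ (n + 1) := by
      rw [Finset.sum_eq_single n]
      · simp [pow_succ']
      · intro i hi hin
        have : n - i ≠ 0 := by
          have := Finset.mem_range.1 hi
          omega
        simp [this]
      · simp
    rw [hval] at hsum
    refine hsum.congr' ?_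
    filter_upwards [Filter.eventually_ge_atTop 1] with N hN
    have hN0 : (N : ℝ) ≠ 0 := by positivity
    have hN1 : (N : ℝ) + 1 ≠ 0 := by positivity
    rw [binomialMoment_succ_succ, Finset.mul_sum, Finset.mul_sum, Finset.sum_div]
    refine Finset.sum_congr rfl fun i hi => ?_
    have hi' : i ≤ n := by
      have := Finset.mem_range.1 hi
      omega
    have hsplit : ((N : ℝ) + 1) ^ (n + 1) = ((N : ℝ) + 1) * (N + 1) ^ i * (N + 1) ^ (n - i) := by
      rw [mul_assoc, ← pow_add, Nat.add_sub_cancel' hi', pow_succ']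
    push_cast
    rw [hsplit, div_pow, div_pow, one_pow]
    field_simp

/-- The Bernstein polynomials of an entire function converge to it at every point of the line, not
only on the interval of the nodes: the moments of the weights are bounded by the powers of a fixed
number, so that the power series may be summed term by term. -/
theorem tendstoUniformlyOn_bernstein {ι : Type*} {F : ι → ℂ → ℂ} {S : Set ι} (a : ℝ)
    (hF : ∀ p ∈ S, Differentiable ℂ (F p))
    (hb : ∀ R : ℝ, ∃ M : ℝ, ∀ p ∈ S, ∀ z : ℂ, ‖z‖ ≤ R → ‖F p z‖ ≤ M) :
    TendstoUniformlyOn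
      (fun (N : ℕ) p => ∑ j ∈ Finset.range (N + 1),
        (coeffC N j a : ℂ) * F p ((1 - 2 * (j : ℝ) / (N : ℝ) : ℝ) : ℂ))
      (fun p => F p a) Filter.atTop S := by
  set b : ℝ := (1 - a) / 2 with hbdef
  set B : ℝ := max 1 |b| with hBdef
  have hB1 : 1 ≤ B := le_max_left _ _
  have hB0 : 0 < B := by linarith
  have hBb : |b| ≤ B := le_max_right _ _
  obtain ⟨M, hM⟩ := hb (1 + 2 * (2 * B))
  -- the functions in the variable `y` with `λ = 1 - 2y`
  set G : ι → ℂ → ℂ := fun p y => F p (1 - 2 * y) with hG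
  have hGd : ∀ p ∈ S, Differentiable ℂ (G p) := fun p hp =>
    (hF p hp).comp (by fun_prop)
  have hGb : ∀ p ∈ S, ∀ z ∈ Metric.sphere (0 : ℂ) (2 * B), ‖G p z‖ ≤ M := by
    intro p hp z hz
    refine hM p hp _ ?_
    have hz' : ‖z‖ = 2 * B := by simpa using hz
    calc ‖1 - 2 * z‖ ≤ ‖(1 : ℂ)‖ + ‖2 * z‖ := norm_sub_le _ _
      _ = 1 + 2 * (2 * B) := by rw [norm_mul, hz']; simp
  set c : ι → ℕ → ℂ := fun p n => (n.factorial : ℂ)⁻¹ * iteratedDeriv n (G p) 0 with hc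
  have hcb : ∀ p ∈ S, ∀ n, ‖c p n‖ ≤ M / (2 * B) ^ n := by
    intro p hp n
    have h := Complex.norm_iteratedDeriv_le_of_forall_mem_sphere_norm_le n (by positivity)
      (hGd p hp).diffContOnCl (hGb p hp)
    have hn : (0 : ℝ) < n.factorial := by positivity
    simp only [hc, norm_mul, norm_inv, Complex.norm_natCast]
    rw [inv_mul_le_iff₀ hn]
    rwa [mul_div_assoc] at h
  have hser : ∀ p ∈ S, ∀ y : ℂ, HasSum (fun n => c p n * y ^ n) (G p y) := by
    intro p hp y
    have h := Complex.hasSum_taylorSeries_of_entire (hGd p hp) 0 y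
    have e : (fun n : ℕ => ((n.factorial : ℂ)⁻¹ • (y - 0) ^ n • iteratedDeriv n (G p) 0)) =
        fun n => c p n * y ^ n := by
      funext n
      simp only [hc, sub_zero, smul_eq_mul]
      ring
    rwa [e] at h
  have hnode : ∀ p ∈ S, ∀ N : ℕ, HasSum (fun n => c p n *
      ((binomialMoment N n a / (N : ℝ) ^ n : ℝ) : ℂ))
      (∑ j ∈ Finset.range (N + 1),
        (coeffC N j a : ℂ) * F p ((1 - 2 * (j : ℝ) / (N : ℝ) : ℝ) : ℂ)) := by
    intro p hp N
    have h := hasSum_sum (s := Finset.range (N + 1)) fun j _ =>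
      (hser p hp ((j : ℂ) / N)).mul_left (coeffC N j a : ℂ)
    have e1 : (fun n => ∑ j ∈ Finset.range (N + 1), (coeffC N j a : ℂ) *
        (c p n * ((j : ℂ) / N) ^ n)) =
        fun n => c p n * ((binomialMoment N n a / (N : ℝ) ^ n : ℝ) : ℂ) := by
      funext n
      simp only [binomialMoment, Complex.ofReal_div, Complex.ofReal_sum, Complex.ofReal_mul,
        Complex.ofReal_pow, Complex.ofReal_natCast, Finset.sum_div, Finset.mul_sum, div_pow]
      refine Finset.sum_congr rfl fun j _ => ?_
      ring
    have e2 : ∑ j ∈ Finset.range (N + 1), (coeffC N j a : ℂ) * G p ((j : ℂ) / N) =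
        ∑ j ∈ Finset.range (N + 1),
          (coeffC N j a : ℂ) * F p ((1 - 2 * (j : ℝ) / (N : ℝ) : ℝ) : ℂ) := by
      refine Finset.sum_congr rfl fun j _ => ?_
      simp only [hG]
      congr 2
      push_cast
      ring
    rwa [e1, e2] at h
  have hlim : ∀ p ∈ S, HasSum (fun n => c p n * ((b ^ n : ℝ) : ℂ)) (F p a) := by
    intro p hp
    have h := hser p hp b
    have h2 : G p b = F p a := by
      simp only [hG, hbdef]
      congr 1
      push_cast
      ring
    rw [h2] at h
    simpa using h
  -- the error is at most `err N`, which tends to zero by dominated convergence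
  set err : ℕ → ℝ := fun N => ∑' n, |M| / (2 * B) ^ n * |binomialMoment N n a / (N : ℝ) ^ n - b ^ n|
    with herr
  have hdom : ∀ N : ℕ, 1 ≤ N → ∀ n, ‖|M| / (2 * B) ^ n *
      |binomialMoment N n a / (N : ℝ) ^ n - b ^ n|‖ ≤ 2 * |M| * (1 / 2) ^ n := by
    intro N hN n
    have hNn : (0 : ℝ) < (N : ℝ) ^ n := by positivity
    have h1 : |binomialMoment N n a / (N : ℝ) ^ n| ≤ B ^ n := by
      rw [abs_div, abs_of_pos hNn, div_le_iff₀ hNn, mul_comm, ← mul_pow]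
      exact abs_binomialMoment_le hB1 hBb n N
    have h2 : |b ^ n| ≤ B ^ n := by
      rw [abs_pow]
      exact pow_le_pow_left₀ (abs_nonneg _) hBb n
    have h3 : |binomialMoment N n a / (N : ℝ) ^ n - b ^ n| ≤ 2 * B ^ n :=
      (abs_sub _ _).trans (by linarith)
    rw [Real.norm_eq_abs, abs_of_nonneg (by positivity)]
    calc |M| / (2 * B) ^ n * |binomialMoment N n a / (N : ℝ) ^ n - b ^ n|
        ≤ |M| / (2 * B) ^ n * (2 * B ^ n) := by gcongr
      _ = 2 * |M| * (1 / 2) ^ n := by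
        rw [mul_pow, div_pow, one_pow]
        field_simp
  have hsummable : Summable fun n : ℕ => 2 * |M| * (1 / 2 : ℝ) ^ n :=
    summable_geometric_two.mul_left _
  have herr0 : Filter.Tendsto err Filter.atTop (nhds 0) := by
    have h := tendsto_tsum_of_dominated_convergence (𝓕 := Filter.atTop)
      (f := fun (N : ℕ) n => |M| / (2 * B) ^ n * |binomialMoment N n a / (N : ℝ) ^ n - b ^ n|)
      (g := fun _ => 0) hsummable
      (fun n => by
        have h := (((tendsto_binomialMoment a n).sub_const (b ^ n)).abs).const_mul
          (|M| / (2 * B) ^ n)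
        simpa [hbdef] using h)
      (Filter.eventually_atTop.2 ⟨1, hdom⟩)
    simpa using h
  rw [Metric.tendstoUniformlyOn_iff]
  intro ε hε
  filter_upwards [herr0.eventually_lt_const hε, Filter.eventually_ge_atTop 1] with N hN hN1 p hp
  refine lt_of_le_of_lt ?_ hN
  rw [dist_comm, dist_eq_norm]
  have hdiff := (hnode p hp N).sub (hlim p hp)
  rw [← hdiff.tsum_eq]
  refine tsum_of_norm_bounded
    (Summable.of_norm_bounded hsummable (hdom N hN1)).hasSum fun n => ?_
  rw [← mul_sub, norm_mul, ← Complex.ofReal_sub, Complex.norm_real, Real.norm_eq_abs]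
  gcongr
  refine (hcb p hp n).trans ?_
  gcongr
  exact le_abs_self M

/-! ### The regular region -/

lemma mem_regularRegion_iff {p : ℝ × ℝ} : p ∈ regularRegion ↔ 0 < p.1 ∧ Real.cos p.1 ≠ 0 := by
  have h : p ∈ regularRegion ↔ 0 < p.1 ∧ ¬ ∃ k : ℕ, p.1 = Real.pi * (2 * (k : ℝ) + 1) / 2 :=
    Iff.rfl
  rw [h]
  refine and_congr_right fun hp => not_congr ?_
  rw [Real.cos_eq_zero_iff]
  constructor
  · rintro ⟨k, hk⟩
    exact ⟨k, by rw [hk]; push_cast; ring⟩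
  · rintro ⟨k, hk⟩
    have h0 : (0 : ℝ) < 2 * (k : ℝ) + 1 := by
      by_contra hneg
      have := mul_nonpos_of_nonpos_of_nonneg (not_lt.1 hneg) Real.pi_pos.le
      linarith
    have hk0 : 0 ≤ k := by
      have : (0 : ℤ) < 2 * k + 1 := by exact_mod_cast h0
      omega
    lift k to ℕ using hk0
    exact ⟨k, by rw [hk]; push_cast; ring⟩

lemma isOpen_regularRegion : IsOpen regularRegion := by
  have h : regularRegion = {p : ℝ × ℝ | 0 < p.1} ∩ {p | Real.cos p.1 ≠ 0} := by
    ext p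
    exact mem_regularRegion_iff
  rw [h]
  exact (isOpen_lt continuous_const continuous_fst).inter
    (isOpen_ne_fun (by fun_prop) continuous_const)

/-! ### The wave function of a character -/

/-- The number of caustics `t = (2k+1)π/2` crossed up to the time `t`. -/
def maslovIndex (t : ℝ) : ℤ := ⌊t / Real.pi + 1 / 2⌋

lemma maslovIndex_eq_iff {t : ℝ} {k : ℤ} :
    maslovIndex t = k ↔ Real.pi * k - Real.pi / 2 ≤ t ∧ t < Real.pi * k + Real.pi / 2 := by
  have hpi := Real.pi_pos
  rw [maslovIndex, Int.floor_eq_iff, ← sub_le_iff_le_add, le_div_iff₀ hpi, ← lt_sub_iff_add_lt,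
    div_lt_iff₀ hpi]
  constructor <;> rintro ⟨h1, h2⟩ <;> constructor <;> linarith

lemma eventually_maslovIndex_eq {t : ℝ} (ht : Real.cos t ≠ 0) :
    ∀ᶠ s in nhds t, maslovIndex s = maslovIndex t := by
  obtain ⟨h1, h2⟩ := maslovIndex_eq_iff.1 (rfl : maslovIndex t = maslovIndex t)
  have h1' : Real.pi * maslovIndex t - Real.pi / 2 < t := by
    refine lt_of_le_of_ne h1 fun h => ht ?_
    rw [Real.cos_eq_zero_iff]
    exact ⟨maslovIndex t - 1, by push_cast; linear_combination -h⟩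
  filter_upwards [Ioo_mem_nhds h1' h2] with s hs
  exact maslovIndex_eq_iff.2 ⟨hs.1.le, hs.2⟩

/-- The complex phase of the wave: minus one half of `log |cos t|` (the real logarithm is even),
the Maslov phase `-iπm/2`, and the phase `-i (x² + λ²) tan t / 2 + iλx / cos t`. The frequency
`λ` may be complex. -/
def wavePhase (l : ℂ) (p : ℝ × ℝ) : ℂ :=
  ((-(1 / 2) * Real.log (Real.cos p.1) : ℝ) : ℂ) +
    -(Complex.I * Real.pi / 2) * (maslovIndex p.1 : ℂ) +
    -(Complex.I / 2) * ((p.2 : ℂ) ^ 2 + l ^ 2) * (Real.tan p.1 : ℂ) +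
    Complex.I * l * p.2 * ((Real.cos p.1)⁻¹ : ℝ)

/-- The solution of `i ∂ψ/∂t = ℋψ` with `ψ(0,x) = e^{iλx}`, off the caustics. -/
def wave (l : ℂ) (p : ℝ × ℝ) : ℂ := Complex.exp (wavePhase l p)

/-! ### Polynomial families and wave families -/

/-- Polynomials in the frequency `λ` with coefficients that are smooth on the regular region. -/
inductive IsPolyFamily : (ℂ → ℝ × ℝ → ℂ) → Prop
  | coeff {q : ℝ × ℝ → ℂ} (hq : ContDiffOn ℝ ∞ q regularRegion) : IsPolyFamily fun _ p => q p
  | param {Q : ℂ → ℝ × ℝ → ℂ} (hQ : IsPolyFamily Q) : IsPolyFamily fun l p => l * Q l p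
  | add {Q R : ℂ → ℝ × ℝ → ℂ} (hQ : IsPolyFamily Q) (hR : IsPolyFamily R) :
      IsPolyFamily fun l p => Q l p + R l p

namespace IsPolyFamily

variable {Q R : ℂ → ℝ × ℝ → ℂ}

lemma contDiffOn (hQ : IsPolyFamily Q) (l : ℂ) : ContDiffOn ℝ ∞ (Q l) regularRegion := by
  induction hQ with
  | coeff hq => exact hq
  | param _ ih => exact contDiffOn_const.mul ih
  | add _ _ ih₁ ih₂ => exact ih₁.add ih₂

lemma differentiable (hQ : IsPolyFamily Q) (p : ℝ × ℝ) : Differentiable ℂ fun l => Q l p := by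
  induction hQ with
  | coeff hq => exact differentiable_const _
  | param _ ih => exact differentiable_id.mul ih
  | add _ _ ih₁ ih₂ => exact ih₁.add ih₂

lemma continuousOn (hQ : IsPolyFamily Q) :
    ContinuousOn (fun z : ℂ × (ℝ × ℝ) => Q z.1 z.2) (Set.univ ×ˢ regularRegion) := by
  induction hQ with
  | coeff hq => exact hq.continuousOn.comp continuousOn_snd fun z hz => hz.2
  | param _ ih => exact continuousOn_fst.mul ih
  | add _ _ ih₁ ih₂ => exact ih₁.add ih₂

lemma congr (hQ : IsPolyFamily Q) (h : ∀ l p, R l p = Q l p) : IsPolyFamily R := by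
  have : R = Q := by
    funext l p
    exact h l p
  rwa [this]

lemma coeff_mul {q : ℝ × ℝ → ℂ} (hq : ContDiffOn ℝ ∞ q regularRegion) (hQ : IsPolyFamily Q) :
    IsPolyFamily fun l p => q p * Q l p := by
  induction hQ with
  | coeff hq' => exact coeff (hq.mul hq')
  | param _ ih => exact ih.param.congr fun l p => by ring
  | add _ _ ih₁ ih₂ => exact (ih₁.add ih₂).congr fun l p => by ring

lemma mul (hQ : IsPolyFamily Q) (hR : IsPolyFamily R) : IsPolyFamily fun l p => Q l p * R l p := by
  induction hQ with
  | coeff hq => exact hR.coeff_mul hq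
  | param _ ih => exact ih.param.congr fun l p => by ring
  | add _ _ ih₁ ih₂ => exact (ih₁.add ih₂).congr fun l p => by ring

end IsPolyFamily

lemma differentiableAt_of_contDiffOn {f : ℝ × ℝ → ℂ} (hf : ContDiffOn ℝ ∞ f regularRegion)
    {p : ℝ × ℝ} (hp : p ∈ regularRegion) : DifferentiableAt ℝ f p :=
  (hf.contDiffAt (isOpen_regularRegion.mem_nhds hp)).differentiableAt (by simp)

lemma contDiffOn_fderiv_apply {f : ℝ × ℝ → ℂ} (hf : ContDiffOn ℝ ∞ f regularRegion) (v : ℝ × ℝ) :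
    ContDiffOn ℝ ∞ (fun p => fderiv ℝ f p v) regularRegion :=
  (hf.fderiv_of_isOpen isOpen_regularRegion (m := ∞) (by simp)).clm_apply contDiffOn_const

lemma IsPolyFamily.exists_fderiv {Q : ℂ → ℝ × ℝ → ℂ} (hQ : IsPolyFamily Q) (v : ℝ × ℝ) :
    ∃ Q', IsPolyFamily Q' ∧ ∀ l, ∀ p ∈ regularRegion, fderiv ℝ (Q l) p v = Q' l p := by
  induction hQ with
  | coeff hq => exact ⟨_, coeff (contDiffOn_fderiv_apply hq v), fun l p _ => rfl⟩
  | @param Q hQ ih =>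
    obtain ⟨Q', hQ', h⟩ := ih
    refine ⟨_, hQ'.param, fun l p hp => ?_⟩
    have hd := (differentiableAt_of_contDiffOn (hQ.contDiffOn l) hp).hasFDerivAt.const_mul l
    rw [hd.fderiv, ← h l p hp]
    simp
  | add hQ hR ih₁ ih₂ =>
    obtain ⟨Q', hQ', h⟩ := ih₁
    obtain ⟨R', hR', h'⟩ := ih₂
    refine ⟨_, hQ'.add hR', fun l p hp => ?_⟩
    have hd := (differentiableAt_of_contDiffOn (hQ.contDiffOn l) hp).hasFDerivAt.add
      (differentiableAt_of_contDiffOn (hR.contDiffOn l) hp).hasFDerivAt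
    rw [← h l p hp, ← h' l p hp]
    exact congrArg (fun L => L v) hd.fderiv

lemma isPolyFamily_wavePhase : IsPolyFamily wavePhase := by
  have hcos : ∀ p ∈ regularRegion, Real.cos p.1 ≠ 0 := fun p hp => (mem_regularRegion_iff.1 hp).2
  have hc : ContDiffOn ℝ ∞ (fun p : ℝ × ℝ => Real.cos p.1) regularRegion :=
    (Real.contDiff_cos.comp contDiff_fst).contDiffOn
  have hlog : ContDiffOn ℝ ∞
      (fun p : ℝ × ℝ => ((-(1 / 2) * Real.log (Real.cos p.1) : ℝ) : ℂ)) regularRegion :=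
    Complex.ofRealCLM.contDiff.comp_contDiffOn (contDiffOn_const.mul (hc.log hcos))
  have htan : ContDiffOn ℝ ∞ (fun p : ℝ × ℝ => (Real.tan p.1 : ℂ)) regularRegion := by
    refine Complex.ofRealCLM.contDiff.comp_contDiffOn (f := fun p : ℝ × ℝ => Real.tan p.1) ?_
    intro p hp
    exact ((Real.contDiffAt_tan.2 (hcos p hp)).comp p contDiffAt_fst).contDiffWithinAt
  have hsec : ContDiffOn ℝ ∞ (fun p : ℝ × ℝ => (((Real.cos p.1)⁻¹ : ℝ) : ℂ)) regularRegion :=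
    Complex.ofRealCLM.contDiff.comp_contDiffOn (hc.inv hcos)
  have hx : ContDiffOn ℝ ∞ (fun p : ℝ × ℝ => (p.2 : ℂ)) regularRegion :=
    (Complex.ofRealCLM.contDiff.comp contDiff_snd).contDiffOn
  have hm : ContDiffOn ℝ ∞ (fun p : ℝ × ℝ => (maslovIndex p.1 : ℂ)) regularRegion := by
    intro p hp
    refine (ContDiffAt.congr_of_eventuallyEq
      (contDiffAt_const (c := (maslovIndex p.1 : ℂ))) ?_).contDiffWithinAt
    filter_upwards [continuous_fst.continuousAt.eventually
      (eventually_maslovIndex_eq (hcos p hp))] with q hq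
    rw [hq]
  have h0 := (IsPolyFamily.coeff hlog).add (IsPolyFamily.coeff
    (((contDiffOn_const (c := -(Complex.I * Real.pi / 2))).mul hm)))
  have h2 := (IsPolyFamily.coeff (((contDiffOn_const (c := -(Complex.I / 2))).mul
    (hx.pow 2)).mul htan))
  have h3 := (IsPolyFamily.coeff ((contDiffOn_const (c := -(Complex.I / 2))).mul htan)).param.param
  have h4 := (IsPolyFamily.coeff (((contDiffOn_const (c := Complex.I)).mul hx).mul hsec)).param
  refine (((h0.add h2).add h3).add h4).congr fun l p => ?_
  simp only [wavePhase]
  ring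

lemma contDiffOn_wave (l : ℂ) : ContDiffOn ℝ ∞ (wave l) regularRegion :=
  Complex.contDiff_exp.comp_contDiffOn (isPolyFamily_wavePhase.contDiffOn l)

/-- The products of the wave with a polynomial family, on the regular region. -/
def IsWaveFamily (G : ℂ → ℝ × ℝ → ℂ) : Prop :=
  ∃ Q, IsPolyFamily Q ∧ ∀ l, ∀ p ∈ regularRegion, G l p = wave l p * Q l p

namespace IsWaveFamily

variable {G H : ℂ → ℝ × ℝ → ℂ}

lemma congr (hG : IsWaveFamily G) (h : ∀ l, Set.EqOn (H l) (G l) regularRegion) :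
    IsWaveFamily H := by
  obtain ⟨Q, hQ, hGQ⟩ := hG
  exact ⟨Q, hQ, fun l p hp => (h l hp).trans (hGQ l p hp)⟩

lemma contDiffOn (hG : IsWaveFamily G) (l : ℂ) : ContDiffOn ℝ ∞ (G l) regularRegion := by
  obtain ⟨Q, hQ, h⟩ := hG
  exact ((contDiffOn_wave l).mul (hQ.contDiffOn l)).congr fun p hp => h l p hp

lemma fderiv_apply (hG : IsWaveFamily G) (v : ℝ × ℝ) :
    IsWaveFamily fun l p => fderiv ℝ (G l) p v := by
  obtain ⟨Q, hQ, h⟩ := hG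
  obtain ⟨Q', hQ', hd⟩ := hQ.exists_fderiv v
  obtain ⟨S', hS', hdS⟩ := isPolyFamily_wavePhase.exists_fderiv v
  refine ⟨_, (hS'.mul hQ).add hQ', fun l p hp => ?_⟩
  have he : G l =ᶠ[nhds p] wave l * Q l := by
    filter_upwards [isOpen_regularRegion.mem_nhds hp] with q hq using h l q hq
  have h1 : HasFDerivAt (wave l) _ p := (differentiableAt_of_contDiffOn
    (isPolyFamily_wavePhase.contDiffOn l) hp).hasFDerivAt.cexp
  have h2 := (differentiableAt_of_contDiffOn (hQ.contDiffOn l) hp).hasFDerivAt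
  simp only
  rw [he.fderiv_eq, (h1.mul h2).fderiv, ← hd l p hp, ← hdS l p hp]
  simp only [wave, add_apply, smul_apply, smul_eq_mul]
  ring

lemma coeff_mul {q : ℝ × ℝ → ℂ} (hq : ContDiffOn ℝ ∞ q regularRegion) (hG : IsWaveFamily G) :
    IsWaveFamily fun l p => q p * G l p := by
  obtain ⟨Q, hQ, h⟩ := hG
  refine ⟨_, hQ.coeff_mul hq, fun l p hp => ?_⟩
  simp only [h l p hp]
  ring

lemma neg_add (hG : IsWaveFamily G) (hH : IsWaveFamily H) :
    IsWaveFamily fun l p => -(G l p) + H l p := by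
  obtain ⟨Q, hQ, h⟩ := hG
  obtain ⟨R, hR, h'⟩ := hH
  refine ⟨_, (hQ.coeff_mul (q := fun _ => -1) contDiffOn_const).add hR, fun l p hp => ?_⟩
  simp only [h l p hp, h' l p hp]
  ring

/-- The supershift property of a wave family, uniformly on compact sets. -/
lemma tendstoUniformlyOn (hG : IsWaveFamily G) (a : ℝ) {K : Set (ℝ × ℝ)} (hK : IsCompact K)
    (hKr : K ⊆ regularRegion) :
    TendstoUniformlyOn
      (fun (N : ℕ) p => ∑ j ∈ Finset.range (N + 1),
        (coeffC N j a : ℂ) * G ((1 - 2 * (j : ℝ) / (N : ℝ) : ℝ) : ℂ) p)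
      (G a) Filter.atTop K := by
  obtain ⟨Q, hQ, h⟩ := hG
  refine tendstoUniformlyOn_bernstein (F := fun p l => G l p) a (fun p hp => ?_) fun R => ?_
  · have he : (fun l => G l p) = fun l => Complex.exp (wavePhase l p) * Q l p := by
      funext l
      exact h l p (hKr hp)
    rw [he]
    exact (isPolyFamily_wavePhase.differentiable p).cexp.mul (hQ.differentiable p)
  · have hcont : ContinuousOn (fun z : ℂ × (ℝ × ℝ) => G z.1 z.2)
        (Metric.closedBall 0 R ×ˢ K) := by
      have hsub : (Metric.closedBall (0 : ℂ) R ×ˢ K : Set (ℂ × (ℝ × ℝ))) ⊆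
          Set.univ ×ˢ regularRegion := Set.prod_mono (Set.subset_univ _) hKr
      refine ((isPolyFamily_wavePhase.continuousOn.cexp.mul hQ.continuousOn).mono hsub).congr ?_
      intro z hz
      exact h z.1 z.2 (hKr hz.2)
    obtain ⟨M, hM⟩ := ((isCompact_closedBall (0 : ℂ) R).prod hK).exists_bound_of_continuousOn hcont
    exact ⟨M, fun p hp z hz => hM (z, p) ⟨by simpa using hz, hp⟩⟩

end IsWaveFamily

lemma isWaveFamily_wave : IsWaveFamily wave :=
  ⟨_, IsPolyFamily.coeff (q := fun _ => 1) contDiffOn_const, fun _ _ _ => (mul_one _).symm⟩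

/-! ### Differential operators on the regular region -/

/-- The properties of a linear differential operator with smooth coefficients that are used: it
acts on the smooth functions on the regular region, it is local and linear there, and it preserves
the wave families. -/
structure IsRegularOp (A : (ℝ × ℝ → ℂ) → ℝ × ℝ → ℂ) : Prop where
  contDiffOn : ∀ {f}, ContDiffOn ℝ ∞ f regularRegion → ContDiffOn ℝ ∞ (A f) regularRegion
  eqOn : ∀ {f g}, ContDiffOn ℝ ∞ f regularRegion → Set.EqOn f g regularRegion →
    Set.EqOn (A f) (A g) regularRegion
  add : ∀ {f g}, ContDiffOn ℝ ∞ f regularRegion → ContDiffOn ℝ ∞ g regularRegion →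
    Set.EqOn (A fun p => f p + g p) (fun p => A f p + A g p) regularRegion
  const_mul : ∀ {f} (c : ℂ), ContDiffOn ℝ ∞ f regularRegion →
    Set.EqOn (A fun p => c * f p) (fun p => c * A f p) regularRegion
  isWaveFamily : ∀ {G}, IsWaveFamily G → IsWaveFamily fun l => A (G l)

namespace IsRegularOp

variable {A B : (ℝ × ℝ → ℂ) → ℝ × ℝ → ℂ}

lemma id : IsRegularOp fun f => f :=
  ⟨fun h => h, fun _ h => h, fun _ _ _ _ => rfl, fun _ _ _ _ => rfl, fun h => h⟩

lemma comp (hA : IsRegularOp A) (hB : IsRegularOp B) : IsRegularOp fun f => A (B f) where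
  contDiffOn hf := hA.contDiffOn (hB.contDiffOn hf)
  eqOn hf h := hA.eqOn (hB.contDiffOn hf) (hB.eqOn hf h)
  add hf hg := (hA.eqOn (hB.contDiffOn (hf.add hg)) (hB.add hf hg)).trans
    (hA.add (hB.contDiffOn hf) (hB.contDiffOn hg))
  const_mul c hf := (hA.eqOn (hB.contDiffOn (contDiffOn_const.mul hf)) (hB.const_mul c hf)).trans
    (hA.const_mul c (hB.contDiffOn hf))
  isWaveFamily hG := hA.isWaveFamily (hB.isWaveFamily hG)

lemma iterate (hA : IsRegularOp A) (n : ℕ) : IsRegularOp A^[n] := by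
  induction n with
  | zero => exact IsRegularOp.id
  | succ n ih => exact ih.comp hA

lemma congr (hA : IsRegularOp A) (h : ∀ {f}, ContDiffOn ℝ ∞ f regularRegion →
    Set.EqOn (B f) (A f) regularRegion) : IsRegularOp B where
  contDiffOn hf := (hA.contDiffOn hf).congr (h hf)
  eqOn hf hfg := (h hf).trans ((hA.eqOn hf hfg).trans
    (h (hf.congr fun p hp => (hfg hp).symm)).symm)
  add hf hg p hp := by
    refine (h (hf.add hg) hp).trans ((hA.add hf hg hp).trans ?_)
    simp only [h hf hp, h hg hp]
  const_mul c hf p hp := by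
    refine (h (contDiffOn_const.mul hf) hp).trans ((hA.const_mul c hf hp).trans ?_)
    simp only [h hf hp]
  isWaveFamily hG := (hA.isWaveFamily hG).congr fun l => h (hG.contDiffOn l)

lemma fderiv_apply (v : ℝ × ℝ) : IsRegularOp fun f p => fderiv ℝ f p v where
  contDiffOn hf := contDiffOn_fderiv_apply hf v
  eqOn _ h p hp := by
    have he := Filter.eventuallyEq_of_mem (isOpen_regularRegion.mem_nhds hp) h
    simp only [he.fderiv_eq]
  add hf hg p hp := congrArg (fun L => L v) ((differentiableAt_of_contDiffOn hf hp).hasFDerivAt.add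
    (differentiableAt_of_contDiffOn hg hp).hasFDerivAt).fderiv
  const_mul c hf p hp := by
    have h := ((differentiableAt_of_contDiffOn hf hp).hasFDerivAt.const_mul c).fderiv
    simp only [h]
    simp
  isWaveFamily hG := hG.fderiv_apply v

lemma neg_add_mul (hA : IsRegularOp A) {q : ℝ × ℝ → ℂ} (hq : ContDiffOn ℝ ∞ q regularRegion) :
    IsRegularOp fun f p => -(A f p) + q p * f p where
  contDiffOn hf := (hA.contDiffOn hf).neg.add (hq.mul hf)
  eqOn hf h p hp := by simp only [hA.eqOn hf h hp, h hp]
  add hf hg p hp := by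
    simp only [hA.add hf hg hp]
    ring
  const_mul c hf p hp := by
    simp only [hA.const_mul c hf hp]
    ring
  isWaveFamily hG := (hA.isWaveFamily hG).neg_add (hG.coeff_mul hq)

lemma sum (hA : IsRegularOp A) {ι : Type*} (s : Finset ι) (c : ι → ℂ) {f : ι → ℝ × ℝ → ℂ}
    (hf : ∀ i, ContDiffOn ℝ ∞ (f i) regularRegion) :
    Set.EqOn (A fun p => ∑ i ∈ s, c i * f i p) (fun p => ∑ i ∈ s, c i * A (f i) p)
      regularRegion := by
  classical
  induction s using Finset.induction_on with
  | empty =>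
    intro p hp
    have h := hA.const_mul (f := fun _ => 0) 0 contDiffOn_const hp
    simpa using h
  | insert i s hi ih =>
    intro p hp
    simp only [Finset.sum_insert hi]
    have h := hA.add (f := fun p => c i * f i p) (g := fun p => ∑ i ∈ s, c i * f i p)
      (contDiffOn_const.mul (hf i)) (ContDiffOn.sum fun j _ => contDiffOn_const.mul (hf j)) hp
    simp only [h, ih hp, hA.const_mul _ (hf i) hp]

/-- Two operators that commute on the smooth functions have commuting iterates. -/
lemma iterate_comm (hA : IsRegularOp A) (hB : IsRegularOp B)
    (h : ∀ {f}, ContDiffOn ℝ ∞ f regularRegion → Set.EqOn (A (B f)) (B (A f)) regularRegion)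
    (n : ℕ) {f : ℝ × ℝ → ℂ} (hf : ContDiffOn ℝ ∞ f regularRegion) :
    Set.EqOn (A (B^[n] f)) (B^[n] (A f)) regularRegion := by
  induction n with
  | zero => exact fun _ _ => rfl
  | succ n ih =>
    rw [Function.iterate_succ_apply', Function.iterate_succ_apply']
    exact (h ((hB.iterate n).contDiffOn hf)).trans
      (hB.eqOn (hA.contDiffOn ((hB.iterate n).contDiffOn hf)) ih)

lemma tendstoUniformlyOn (hA : IsRegularOp A) (a : ℝ) {K : Set (ℝ × ℝ)} (hK : IsCompact K)
    (hKr : K ⊆ regularRegion) :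
    TendstoUniformlyOn (fun N : ℕ => A (shiftSeq (fun l : ℝ => wave l) a N)) (A (wave a))
      Filter.atTop K := by
  refine ((hA.isWaveFamily isWaveFamily_wave).tendstoUniformlyOn a hK hKr).congr
    (Filter.Eventually.of_forall fun N p hp => ?_)
  exact (hA.sum _ _ (fun j => contDiffOn_wave _) (hKr hp)).symm

end IsRegularOp

lemma hasDerivAt_fst_of_contDiffOn {f : ℝ × ℝ → ℂ} (hf : ContDiffOn ℝ ∞ f regularRegion)
    {p : ℝ × ℝ} (hp : p ∈ regularRegion) :
    HasDerivAt (fun s : ℝ => f (s, p.2)) (fderiv ℝ f p (1, 0)) p.1 :=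
  (differentiableAt_of_contDiffOn hf hp).hasFDerivAt.comp_hasDerivAt p.1
    ((hasDerivAt_id p.1).prodMk (hasDerivAt_const p.1 p.2))

lemma hasDerivAt_snd_of_contDiffOn {f : ℝ × ℝ → ℂ} (hf : ContDiffOn ℝ ∞ f regularRegion)
    {p : ℝ × ℝ} (hp : p ∈ regularRegion) :
    HasDerivAt (fun y : ℝ => f (p.1, y)) (fderiv ℝ f p (0, 1)) p.2 :=
  (differentiableAt_of_contDiffOn hf hp).hasFDerivAt.comp_hasDerivAt p.2
    ((hasDerivAt_const p.2 p.1).prodMk (hasDerivAt_id p.2))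

lemma eqOn_dt {f : ℝ × ℝ → ℂ} (hf : ContDiffOn ℝ ∞ f regularRegion) :
    Set.EqOn (dt f) (fun p => fderiv ℝ f p (1, 0)) regularRegion :=
  fun _ hp => (hasDerivAt_fst_of_contDiffOn hf hp).deriv

lemma eqOn_dx {f : ℝ × ℝ → ℂ} (hf : ContDiffOn ℝ ∞ f regularRegion) :
    Set.EqOn (dx f) (fun p => fderiv ℝ f p (0, 1)) regularRegion :=
  fun _ hp => (hasDerivAt_snd_of_contDiffOn hf hp).deriv

lemma isRegularOp_dt : IsRegularOp dt := (IsRegularOp.fderiv_apply (1, 0)).congr eqOn_dt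

lemma isRegularOp_dx : IsRegularOp dx := (IsRegularOp.fderiv_apply (0, 1)).congr eqOn_dx

lemma contDiffOn_snd_sq : ContDiffOn ℝ ∞ (fun p : ℝ × ℝ => (p.2 : ℂ) ^ 2) regularRegion :=
  ((Complex.ofRealCLM.contDiff.comp contDiff_snd).pow 2).contDiffOn

lemma isRegularOp_oscOp : IsRegularOp oscOp :=
  (isRegularOp_dx.comp isRegularOp_dx).neg_add_mul contDiffOn_snd_sq

lemma dt_dx_comm {f : ℝ × ℝ → ℂ} (hf : ContDiffOn ℝ ∞ f regularRegion) :
    Set.EqOn (dt (dx f)) (dx (dt f)) regularRegion := by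
  intro p hp
  have hsymm := (hf.contDiffAt (isOpen_regularRegion.mem_nhds hp)).isSymmSndFDerivAt (by
    rw [minSmoothness_of_isRCLikeNormedField]
    exact WithTop.coe_le_coe.2 (le_top : (2 : ℕ∞) ≤ ⊤))
  have hdd : DifferentiableAt ℝ (fderiv ℝ f) p :=
    ((hf.fderiv_of_isOpen isOpen_regularRegion (m := ∞) (by simp)).contDiffAt
      (isOpen_regularRegion.mem_nhds hp)).differentiableAt (by simp)
  have key : ∀ v w : ℝ × ℝ, fderiv ℝ (fun q => fderiv ℝ f q v) p w =
      fderiv ℝ (fderiv ℝ f) p w v := by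
    intro v w
    have h := (hdd.hasFDerivAt.clm_apply (hasFDerivAt_const v p)).fderiv
    rw [h]
    simp
  rw [isRegularOp_dt.eqOn (isRegularOp_dx.contDiffOn hf) (eqOn_dx hf) hp,
    isRegularOp_dx.eqOn (isRegularOp_dt.contDiffOn hf) (eqOn_dt hf) hp,
    eqOn_dt (contDiffOn_fderiv_apply hf _) hp, eqOn_dx (contDiffOn_fderiv_apply hf _) hp]
  simp only [key]
  exact hsymm _ _

lemma dt_oscOp_comm {f : ℝ × ℝ → ℂ} (hf : ContDiffOn ℝ ∞ f regularRegion) :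
    Set.EqOn (dt (oscOp f)) (oscOp (dt f)) regularRegion := by
  intro p hp
  have hdx := isRegularOp_dx.contDiffOn hf
  have h1 : Set.EqOn (dt (dx (dx f))) (dx (dx (dt f))) regularRegion :=
    (dt_dx_comm hdx).trans (isRegularOp_dx.eqOn (isRegularOp_dt.contDiffOn hdx) (dt_dx_comm hf))
  have h2 := (hasDerivAt_fst_of_contDiffOn (isRegularOp_dx.contDiffOn hdx) hp).neg.add
    ((hasDerivAt_fst_of_contDiffOn hf hp).const_mul ((p.2 : ℂ) ^ 2))
  have h3 : dt (oscOp f) p = _ := h2.deriv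
  have h4 := eqOn_dt (isRegularOp_dx.contDiffOn hdx) hp
  have h5 := eqOn_dt hf hp
  simp only at h4 h5
  rw [h3, ← h4, ← h5, h1 hp]
  rfl

/-- For a smooth solution of the Schrödinger equation, time derivatives may be traded for powers
of the Hamiltonian. -/
lemma dt_iterate_dx_iterate_eq {f : ℝ × ℝ → ℂ} (hf : ContDiffOn ℝ ∞ f regularRegion)
    (h : Set.EqOn (dt f) (fun p => 1 / (2 * Complex.I) * oscOp f p) regularRegion) (μ ν : ℕ) :
    Set.EqOn (dt^[μ] (dx^[ν] f))
      (fun p => 1 / (2 * Complex.I) ^ μ * dx^[ν] (oscOp^[μ] f) p) regularRegion := by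
  induction μ with
  | zero => exact fun p _ => by simp
  | succ μ ih =>
    intro p hp
    have hosc := (isRegularOp_oscOp.iterate μ).contDiffOn hf
    have hdx := (isRegularOp_dx.iterate ν).contDiffOn hosc
    have e1 := isRegularOp_dt.eqOn
      ((isRegularOp_dt.iterate μ).contDiffOn ((isRegularOp_dx.iterate ν).contDiffOn hf)) ih
    have e2 := isRegularOp_dt.const_mul (1 / (2 * Complex.I) ^ μ) hdx
    have e3 := isRegularOp_dt.iterate_comm isRegularOp_dx dt_dx_comm ν hosc
    have e4 := (isRegularOp_dx.iterate ν).eqOn (isRegularOp_dt.contDiffOn hosc)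
      (isRegularOp_dt.iterate_comm isRegularOp_oscOp dt_oscOp_comm μ hf)
    have e5 := ((isRegularOp_dx.iterate ν).comp (isRegularOp_oscOp.iterate μ)).eqOn
      (isRegularOp_dt.contDiffOn hf) h
    have e6 := ((isRegularOp_dx.iterate ν).comp (isRegularOp_oscOp.iterate μ)).const_mul
      (1 / (2 * Complex.I)) (isRegularOp_oscOp.contDiffOn hf)
    rw [Function.iterate_succ_apply', e1 hp, e2 hp]
    simp only
    rw [e3 hp, e4 hp, e5 hp, e6 hp, Function.iterate_succ_apply]
    ring

/-! ### The Schrödinger equation for the wave -/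

lemma hasDerivAt_wave_snd (l : ℂ) (t x : ℝ) :
    HasDerivAt (fun y : ℝ => wave l (t, y))
      (wave l (t, x) *
        (-(Complex.I * x * Real.tan t) + Complex.I * l * ((Real.cos t)⁻¹ : ℝ))) x := by
  have hx : HasDerivAt (fun y : ℝ => (y : ℂ)) 1 x := Complex.ofRealCLM.hasDerivAt
  have h := ((((hx.pow 2).add_const (l ^ 2)).const_mul (-(Complex.I / 2))).mul_const
    (Real.tan t : ℂ)).const_add (((-(1 / 2) * Real.log (Real.cos t) : ℝ) : ℂ) +
      -(Complex.I * Real.pi / 2) * (maslovIndex t : ℂ)) |>.add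
    ((hx.const_mul (Complex.I * l)).mul_const (((Real.cos t)⁻¹ : ℝ) : ℂ)) |>.cexp
  refine h.congr_deriv ?_
  simp only [wave, wavePhase, Pi.add_apply, Pi.pow_apply]
  push_cast
  ring

lemma hasDerivAt_wave_snd_snd (l : ℂ) (t x : ℝ) :
    HasDerivAt (fun y : ℝ => wave l (t, y) *
        (-(Complex.I * y * Real.tan t) + Complex.I * l * ((Real.cos t)⁻¹ : ℝ)))
      (wave l (t, x) *
        ((-(Complex.I * x * Real.tan t) + Complex.I * l * ((Real.cos t)⁻¹ : ℝ)) ^ 2 -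
          Complex.I * Real.tan t)) x := by
  have hx : HasDerivAt (fun y : ℝ => (y : ℂ)) 1 x := Complex.ofRealCLM.hasDerivAt
  have h := (hasDerivAt_wave_snd l t x).mul ((((hx.const_mul Complex.I).mul_const
    (Real.tan t : ℂ)).neg).add_const (Complex.I * l * ((Real.cos t)⁻¹ : ℝ)))
  refine h.congr_deriv ?_
  simp only [Pi.neg_apply]
  ring

lemma dx_dx_wave (l : ℂ) (p : ℝ × ℝ) : dx (dx (wave l)) p = wave l p *
    ((-(Complex.I * p.2 * Real.tan p.1) + Complex.I * l * ((Real.cos p.1)⁻¹ : ℝ)) ^ 2 -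
      Complex.I * Real.tan p.1) := by
  have h : dx (wave l) = fun p : ℝ × ℝ => wave l p *
      (-(Complex.I * p.2 * Real.tan p.1) + Complex.I * l * ((Real.cos p.1)⁻¹ : ℝ)) := by
    funext p
    exact (hasDerivAt_wave_snd l p.1 p.2).deriv
  rw [h]
  exact (hasDerivAt_wave_snd_snd l p.1 p.2).deriv

lemma hasDerivAt_wave_fst (l : ℂ) {t : ℝ} (ht : Real.cos t ≠ 0) (x : ℝ) :
    HasDerivAt (fun s : ℝ => wave l (s, x))
      (1 / (2 * Complex.I) * oscOp (wave l) (t, x)) t := by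
  have hlog : HasDerivAt (fun s : ℝ => ((-(1 / 2) * Real.log (Real.cos s) : ℝ) : ℂ))
      ((-(1 / 2) * (-Real.sin t / Real.cos t) : ℝ) : ℂ) t :=
    (((Real.hasDerivAt_cos t).log ht).const_mul (-(1 / 2))).ofReal_comp
  have htan : HasDerivAt (fun s : ℝ => (Real.tan s : ℂ)) ((1 / Real.cos t ^ 2 : ℝ) : ℂ) t :=
    (Real.hasDerivAt_tan ht).ofReal_comp
  have hsec : HasDerivAt (fun s : ℝ => (((Real.cos s)⁻¹ : ℝ) : ℂ))
      ((-(-Real.sin t) / Real.cos t ^ 2 : ℝ) : ℂ) t :=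
    ((Real.hasDerivAt_cos t).inv ht).ofReal_comp
  have hm : HasDerivAt (fun s : ℝ => (maslovIndex s : ℂ)) 0 t := by
    refine (hasDerivAt_const t (maslovIndex t : ℂ)).congr_of_eventuallyEq ?_
    filter_upwards [eventually_maslovIndex_eq ht] with s hs
    rw [hs]
  have h := (((hlog.add (hm.const_mul (-(Complex.I * Real.pi / 2)))).add
    (htan.const_mul (-(Complex.I / 2) * ((x : ℂ) ^ 2 + l ^ 2)))).add
    (hsec.const_mul (Complex.I * l * x))).cexp
  refine h.congr_deriv ?_
  have hw : wave l (t, x) = Complex.exp (wavePhase l (t, x)) := rfl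
  have hc : (Real.cos t : ℂ) ≠ 0 := by exact_mod_cast ht
  have hs : (Real.sin t : ℂ) ^ 2 = 1 - (Real.cos t : ℂ) ^ 2 := by
    have := Real.sin_sq_add_cos_sq t
    rw [eq_sub_iff_add_eq]
    exact_mod_cast this
  rw [oscOp, dx_dx_wave, hw, wavePhase]
  simp only [Pi.add_apply]
  generalize Complex.exp _ = E
  rw [Real.tan_eq_sin_div_cos]
  push_cast at hs hc ⊢
  field_simp
  ring_nf
  simp only [Complex.I_sq, hs]
  ring_nf

lemma dt_wave_eq (l : ℂ) :
    Set.EqOn (dt (wave l)) (fun p => 1 / (2 * Complex.I) * oscOp (wave l) p) regularRegion :=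
  fun p hp => (hasDerivAt_wave_fst l (mem_regularRegion_iff.1 hp).2 p.2).deriv

lemma contDiffOn_shiftSeq_wave (a : ℝ) (N : ℕ) :
    ContDiffOn ℝ ∞ (shiftSeq (fun l : ℝ => wave l) a N) regularRegion :=
  ContDiffOn.sum fun _ _ => contDiffOn_const.mul (contDiffOn_wave _)

lemma dt_shiftSeq_wave_eq (a : ℝ) (N : ℕ) :
    Set.EqOn (dt (shiftSeq (fun l : ℝ => wave l) a N))
      (fun p => 1 / (2 * Complex.I) * oscOp (shiftSeq (fun l : ℝ => wave l) a N) p)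
      regularRegion := by
  intro p hp
  refine (isRegularOp_dt.sum _ _ (fun j => contDiffOn_wave _) hp).trans ?_
  have h : oscOp (shiftSeq (fun l : ℝ => wave l) a N) p = _ :=
    isRegularOp_oscOp.sum _ _ (fun j => contDiffOn_wave _) hp
  simp only [h, Finset.mul_sum]
  refine Finset.sum_congr rfl fun j _ => ?_
  rw [dt_wave_eq _ hp]
  ring

/-- The waves form a supershift on the regular region. -/
lemma isSupershift_wave {a : ℝ} (ha : a ∉ Set.Icc (-1 : ℝ) 1) :
    IsSupershift (fun (l : ℝ) (τ : regularRegion) => wave l τ)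
      (fun (N : ℕ) (τ : regularRegion) => shiftSeq (fun l : ℝ => wave l) a N τ) Set.univ := by
  refine ⟨⟨fun N j => coeffC N j a, fun N j => 1 - 2 * (j : ℝ) / (N : ℝ), fun N hN =>
    ⟨fun j hj => ?_, fun τ => rfl⟩⟩, isOpen_univ, a, ha, {1}, fun _ => 1, by simp, ?_⟩
  · have hN0 : (0 : ℝ) < N := by positivity
    have h1 : (j : ℝ) / N ≤ 1 := (div_le_one hN0).2 (by exact_mod_cast hj)
    have h2 : 0 ≤ (j : ℝ) / N := by positivity
    simp only [abs_le, mul_div_assoc]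
    constructor <;> linarith
  · simp only [Finset.sum_singleton, Int.cast_one, one_mul]
    have : LocallyCompactSpace regularRegion := isOpen_regularRegion.locallyCompactSpace
    rw [tendstoLocallyUniformlyOn_iff_forall_isCompact isOpen_univ]
    intro K _ hK
    have h := (IsRegularOp.id.tendstoUniformlyOn a (hK.image continuous_subtype_val)
      (by rintro _ ⟨τ, _, rfl⟩; exact τ.2)).comp (Subtype.val : regularRegion → ℝ × ℝ)
    exact h.mono fun τ hτ => ⟨τ, hτ, rfl⟩

open scoped FourierTransform
open Filter Topology
open MeasureTheory (Integrable)

/-! ### Schwartz functions that extend to the strip `|Im z| ≤ 1` -/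

lemma iteratedDeriv_comp_ofReal {Q : ℂ → ℂ} (hQ : Differentiable ℂ Q) (n : ℕ) :
    iteratedDeriv n (fun x : ℝ => Q x) = fun x : ℝ => iteratedDeriv n Q x := by
  induction n with
  | zero => simp
  | succ n ih =>
    rw [iteratedDeriv_succ, ih, iteratedDeriv_succ]
    funext x
    have h : DifferentiableAt ℂ (iteratedDeriv n Q) x :=
      (hQ.contDiff (n := n + 1)).differentiable_iteratedDeriv n
        (by exact_mod_cast Nat.lt_succ_self n) x
    exact h.hasDerivAt.comp_ofReal.deriv

lemma contDiff_comp_ofReal {Q : ℂ → ℂ} (hQ : Differentiable ℂ Q) :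
    ContDiff ℝ ∞ fun x : ℝ => Q x :=
  (hQ.contDiff.restrict_scalars ℝ).comp Complex.ofRealCLM.contDiff

/-- Cauchy's estimates turn a decay of an entire function on the strip `|Im z| ≤ 1` into bounds of
all Schwartz seminorms of its restriction to the real line. -/
lemma pow_mul_norm_iteratedDeriv_le {Q : ℂ → ℂ} (hQ : Differentiable ℂ Q) {ε : ℝ}
    (hε : ∀ z : ℂ, |z.im| ≤ 1 → ‖Q z‖ ≤ ε * Real.exp (-|z.re|)) (k n : ℕ) (x : ℝ) :
    |x| ^ k * ‖iteratedDeriv n (fun x : ℝ => Q x) x‖ ≤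
      (k.factorial * n.factorial * Real.exp 1) * ε := by
  have hε0 : 0 ≤ ε := by
    have h := (norm_nonneg _).trans (hε 0 (by simp))
    simpa using h
  have h1 : ‖iteratedDeriv n Q x‖ ≤ n.factorial * (ε * Real.exp (1 - |x|)) / 1 ^ n := by
    refine Complex.norm_iteratedDeriv_le_of_forall_mem_sphere_norm_le n one_pos hQ.diffContOnCl
      fun z hz => ?_
    have hz' : ‖z - x‖ = 1 := by simpa [dist_eq_norm] using hz
    have him : |z.im| ≤ 1 := by
      have h := Complex.abs_im_le_norm (z - x)
      rw [hz'] at h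
      simpa using h
    have hre : |x| - 1 ≤ |z.re| := by
      have h := Complex.abs_re_le_norm (z - x)
      rw [hz', Complex.sub_re, Complex.ofReal_re] at h
      have h2 := abs_sub_abs_le_abs_sub x z.re
      rw [abs_sub_comm] at h2
      linarith
    refine (hε z him).trans ?_
    gcongr
    linarith
  rw [one_pow, div_one] at h1
  have h2 : |x| ^ k ≤ k.factorial * Real.exp |x| := by
    have h := Real.pow_div_factorial_le_exp |x| (abs_nonneg x) k
    rwa [div_le_iff₀ (by positivity), mul_comm] at h
  rw [iteratedDeriv_comp_ofReal hQ]
  calc |x| ^ k * ‖iteratedDeriv n Q x‖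
      ≤ (k.factorial * Real.exp |x|) * (n.factorial * (ε * Real.exp (1 - |x|))) := by gcongr
    _ = (k.factorial * n.factorial * Real.exp (|x| + (1 - |x|))) * ε := by
      rw [Real.exp_add]
      ring
    _ = (k.factorial * n.factorial * Real.exp 1) * ε := by
      congr 3
      ring

/-- The restriction to the real line of an entire function that decays on the strip
`|Im z| ≤ 1`. -/
def schwartzOfStrip (Q : ℂ → ℂ) (hQ : Differentiable ℂ Q)
    (h : ∃ ε : ℝ, ∀ z : ℂ, |z.im| ≤ 1 → ‖Q z‖ ≤ ε * Real.exp (-|z.re|)) : 𝓢(ℝ, ℂ) where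
  toFun x := Q x
  smooth' := contDiff_comp_ofReal hQ
  decay' k n := by
    obtain ⟨ε, hε⟩ := h
    refine ⟨(k.factorial * n.factorial * Real.exp 1) * ε, fun x => ?_⟩
    rw [norm_iteratedFDeriv_eq_norm_iteratedDeriv]
    exact pow_mul_norm_iteratedDeriv_le hQ hε k n x

lemma exp_mul_norm_exp_neg_sq_le {A : ℝ} (hA : 0 ≤ A) (z : ℂ) (hz : |z.im| ≤ 1) :
    Real.exp (A * ‖z‖) * ‖Complex.exp (-z ^ 2 / 2)‖ ≤
      Real.exp ((A + 1) ^ 2 / 2 + A + 1 / 2) * Real.exp (-|z.re|) := by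
  rw [Complex.norm_exp, ← Real.exp_add, ← Real.exp_add]
  have hre : (-z ^ 2 / 2).re = (z.im ^ 2 - z.re ^ 2) / 2 := by
    have : (-z ^ 2 / 2).re = (-z ^ 2).re / 2 := by
      simp
    rw [this, pow_two, Complex.neg_re, Complex.mul_re]
    ring
  have hn : ‖z‖ ≤ |z.re| + 1 := (Complex.norm_le_abs_re_add_abs_im z).trans (by linarith)
  have h1 := mul_le_mul_of_nonneg_left hn hA
  have h2 : z.im ^ 2 ≤ 1 := by
    rw [← sq_abs]
    exact pow_le_one₀ (abs_nonneg _) hz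
  have h3 := sq_abs z.re
  rw [Real.exp_le_exp, hre]
  nlinarith [sq_nonneg (|z.re| - (A + 1))]

lemma tendsto_schwartz_of_seminorm_le {f : ℕ → 𝓢(ℝ, ℂ)} {g : 𝓢(ℝ, ℂ)} {ε : ℕ → ℝ}
    (hε : Tendsto ε atTop (𝓝 0)) (h : ∀ k n : ℕ, ∃ C : ℝ, ∀ N, ∀ x : ℝ,
      |x| ^ k * ‖iteratedDeriv n (f N - g : 𝓢(ℝ, ℂ)) x‖ ≤ C * ε N) :
    Tendsto f atTop (𝓝 g) := by
  rw [(schwartz_withSeminorms ℂ ℝ ℂ).tendsto_nhds f g]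
  rintro ⟨k, n⟩ δ hδ
  obtain ⟨C, hC⟩ := h k n
  have hlim : Tendsto (fun N => C * ε N) atTop (𝓝 0) := by simpa using hε.const_mul C
  filter_upwards [hlim.eventually_lt_const hδ] with N hN
  refine lt_of_le_of_lt (SchwartzMap.seminorm_le_bound' ℂ k n _ ?_ (hC N)) hN
  exact le_trans (by positivity) (hC N 0)

/-! ### Density of the functions with compact support -/

/-- A smooth cutoff equal to `1` on the unit ball. -/
def cutoff : ContDiffBump (0 : ℝ) := ⟨1, 2, one_pos, one_lt_two⟩

/-- The cutoff on the ball of radius `N + 1`, as a complex function. -/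
def dilatedCutoff (N : ℕ) (x : ℝ) : ℂ := ((cutoff ((N + 1 : ℝ)⁻¹ * x) : ℝ) : ℂ)

lemma contDiff_dilatedCutoff (N : ℕ) : ContDiff ℝ ∞ (dilatedCutoff N) :=
  Complex.ofRealCLM.contDiff.comp
    ((cutoff.contDiff (n := ⊤)).comp (contDiff_const.mul contDiff_id))

lemma hasCompactSupport_dilatedCutoff (N : ℕ) : HasCompactSupport (dilatedCutoff N) := by
  have h0 : ((N : ℝ) + 1)⁻¹ ≠ 0 := by positivity
  have h := (cutoff.hasCompactSupport).comp_homeomorph (Homeomorph.mulLeft₀ _ h0)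
  exact h.comp_left (g := fun y : ℝ => (y : ℂ)) Complex.ofReal_zero

/-- The derivatives of the dilated cutoffs are bounded uniformly in the dilation. -/
lemma exists_norm_iteratedDeriv_dilatedCutoff_le (n : ℕ) :
    ∃ C : ℝ, 0 ≤ C ∧ ∀ N x, ‖iteratedDeriv n (dilatedCutoff N) x‖ ≤ C := by
  have hcs : HasCompactSupport fun x : ℝ => ((cutoff x : ℝ) : ℂ) :=
    cutoff.hasCompactSupport.comp_left Complex.ofReal_zero
  have hcd : ContDiff ℝ ∞ fun x : ℝ => ((cutoff x : ℝ) : ℂ) :=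
    Complex.ofRealCLM.contDiff.comp cutoff.contDiff
  refine ⟨SchwartzMap.seminorm ℝ 0 n (hcs.toSchwartzMap hcd), apply_nonneg _ _, fun N x => ?_⟩
  have h := iteratedDeriv_comp_const_smul (n := n) (f := fun x : ℝ => ((cutoff x : ℝ) : ℂ))
    (hcd.of_le (by exact_mod_cast le_top)) ((N + 1 : ℝ)⁻¹)
  have h' : iteratedDeriv n (dilatedCutoff N) x = _ := congrFun h x
  have hle := SchwartzMap.le_seminorm' ℝ 0 n (hcs.toSchwartzMap hcd) ((N + 1 : ℝ)⁻¹ * x)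
  rw [pow_zero, one_mul] at hle
  rw [h', norm_smul]
  refine le_trans (mul_le_of_le_one_left (norm_nonneg _) ?_) hle
  rw [norm_pow, norm_inv]
  refine pow_le_one₀ (by positivity) (inv_le_one_of_one_le₀ ?_)
  rw [Real.norm_of_nonneg (by positivity)]
  linarith [(Nat.cast_nonneg N : (0 : ℝ) ≤ N)]

/-- Truncation by the dilated cutoffs approximates a Schwartz function: the error lives on
`|x| ≥ N + 1`, where one power of `x` gains a factor `1 / (N + 1)`. -/
lemma dense_hasCompactSupport : Dense {f : 𝓢(ℝ, ℂ) | HasCompactSupport f} := by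
  intro f
  have hcs : ∀ N, HasCompactSupport fun x => dilatedCutoff N x * f x := fun N =>
    (hasCompactSupport_dilatedCutoff N).mul_right
  have hcd : ∀ N, ContDiff ℝ ∞ fun x => dilatedCutoff N x * f x := fun N =>
    (contDiff_dilatedCutoff N).mul (f.smooth ⊤)
  refine mem_closure_of_tendsto (f := fun N => (hcs N).toSchwartzMap (hcd N)) (b := atTop)
    (tendsto_schwartz_of_seminorm_le tendsto_one_div_add_atTop_nhds_zero_nat fun k n => ?_)
    (Eventually.of_forall fun N => hcs N)
  choose B hB0 hB using exists_norm_iteratedDeriv_dilatedCutoff_le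
  set p : ℕ → ℝ := fun i => SchwartzMap.seminorm ℝ (k + 1) i f with hp
  refine ⟨∑ i ∈ Finset.range (n + 1), (n.choose i : ℝ) * B i * p (n - i) + p n, fun N x => ?_⟩
  have hp0 : ∀ i, 0 ≤ p i := fun i => apply_nonneg _ _
  have hC0 : 0 ≤ ∑ i ∈ Finset.range (n + 1), (n.choose i : ℝ) * B i * p (n - i) + p n :=
    add_nonneg (Finset.sum_nonneg fun i _ => mul_nonneg (mul_nonneg (by positivity) (hB0 i))
      (hp0 _)) (hp0 n)
  have hN : (0 : ℝ) < N + 1 := by positivity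
  have hfun : ⇑((hcs N).toSchwartzMap (hcd N) - f : 𝓢(ℝ, ℂ)) =
      fun y => dilatedCutoff N y * f y - f y := rfl
  rw [hfun]
  rcases lt_or_ge |x| (N + 1) with hx | hx
  · have he : (fun y => dilatedCutoff N y * f y - f y) =ᶠ[𝓝 x] fun _ => 0 := by
      filter_upwards [continuous_abs.continuousAt.eventually_lt_const hx] with y hy
      have h1 : cutoff ((N + 1 : ℝ)⁻¹ * y) = 1 := by
        refine cutoff.one_of_mem_closedBall ?_
        rw [mem_closedBall_zero_iff, norm_mul, norm_inv, Real.norm_of_nonneg hN.le,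
          inv_mul_le_iff₀ hN]
        simpa [cutoff] using hy.le
      simp [dilatedCutoff, h1]
    rw [he.iteratedDeriv_eq n]
    have h0 : iteratedDeriv n (fun _ : ℝ => (0 : ℂ)) x = 0 := by
      simp
    rw [h0, norm_zero, mul_zero]
    positivity
  · have hmain : ∀ i, |x| ^ k * ‖iteratedDeriv i f x‖ ≤ p i * (1 / (N + 1)) := by
      intro i
      have h := SchwartzMap.le_seminorm' ℝ (k + 1) i f x
      rw [mul_one_div, le_div_iff₀ hN]
      refine le_trans ?_ h
      rw [pow_succ]
      have := mul_le_mul_of_nonneg_left hx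
        (by positivity : 0 ≤ |x| ^ k * ‖iteratedDeriv i f x‖)
      linarith
    have hd : iteratedDeriv n (fun y => dilatedCutoff N y * f y - f y) x =
        iteratedDeriv n (fun y => dilatedCutoff N y * f y) x - iteratedDeriv n f x :=
      iteratedDeriv_fun_sub (((hcd N).of_le (by exact_mod_cast le_top)).contDiffAt)
        ((f.smooth n).contDiffAt)
    have hL := norm_iteratedFDeriv_mul_le (contDiff_dilatedCutoff N) (f.smooth ⊤) x (n := n)
      (by exact_mod_cast le_top)
    simp only [norm_iteratedFDeriv_eq_norm_iteratedDeriv] at hL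
    rw [hd, add_mul]
    calc |x| ^ k * ‖iteratedDeriv n (fun y => dilatedCutoff N y * f y) x - iteratedDeriv n f x‖
        ≤ |x| ^ k * (∑ i ∈ Finset.range (n + 1), (n.choose i : ℝ) *
            ‖iteratedDeriv i (dilatedCutoff N) x‖ * ‖iteratedDeriv (n - i) f x‖ +
            ‖iteratedDeriv n f x‖) := by
          gcongr
          exact (norm_sub_le _ _).trans (by gcongr)
      _ = ∑ i ∈ Finset.range (n + 1), (n.choose i : ℝ) *
            ‖iteratedDeriv i (dilatedCutoff N) x‖ * (|x| ^ k * ‖iteratedDeriv (n - i) f x‖) +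
            |x| ^ k * ‖iteratedDeriv n f x‖ := by
          rw [mul_add, Finset.mul_sum]
          congr 1
          exact Finset.sum_congr rfl fun i _ => by ring
      _ ≤ ∑ i ∈ Finset.range (n + 1), (n.choose i : ℝ) * B i * (p (n - i) * (1 / (N + 1))) +
            p n * (1 / (N + 1)) := by
          refine add_le_add (Finset.sum_le_sum fun i _ => ?_) (hmain n)
          have := hmain (n - i)
          have := hB i N x
          have := hB0 i
          gcongr
      _ = _ := by
          rw [Finset.sum_mul]
          congr 1
          exact Finset.sum_congr rfl fun i _ => by ring

/-! ### Hermite functions -/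

lemma differentiable_pow_mul_gaussian (k : ℕ) :
    Differentiable ℂ fun z : ℂ => z ^ k * Complex.exp (-z ^ 2 / 2) := by
  fun_prop

/-- The functions `x^k e^{-x²/2}`, which span the Hermite functions. -/
def hermiteMonomial (k : ℕ) : 𝓢(ℝ, ℂ) :=
  schwartzOfStrip (fun z => z ^ k * Complex.exp (-z ^ 2 / 2)) (differentiable_pow_mul_gaussian k)
    ⟨k.factorial * Real.exp ((1 + 1) ^ 2 / 2 + 1 + 1 / 2), fun z hz => by
      have h1 := exp_mul_norm_exp_neg_sq_le zero_le_one z hz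
      have h2 : ‖z‖ ^ k ≤ k.factorial * Real.exp (1 * ‖z‖) := by
        have h := Real.pow_div_factorial_le_exp ‖z‖ (norm_nonneg z) k
        rwa [div_le_iff₀ (by positivity), mul_comm, ← one_mul ‖z‖, mul_pow, one_pow, one_mul] at h
      rw [norm_mul, norm_pow, mul_assoc]
      refine le_trans (mul_le_mul_of_nonneg_right h2 (norm_nonneg _)) ?_
      rw [mul_assoc]
      gcongr⟩

lemma hermiteMonomial_apply (k : ℕ) (x : ℝ) :
    hermiteMonomial k x = (x : ℂ) ^ k * Complex.exp (-(x : ℂ) ^ 2 / 2) := rfl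

lemma deriv_hermiteMonomial (k : ℕ) :
    SchwartzMap.derivCLM ℂ ℂ (hermiteMonomial k) =
      (k : ℂ) • hermiteMonomial (k - 1) - hermiteMonomial (k + 1) := by
  ext x
  rw [SchwartzMap.derivCLM_apply]
  have hx : HasDerivAt (fun y : ℝ => (y : ℂ)) 1 x := Complex.ofRealCLM.hasDerivAt
  have h : HasDerivAt (hermiteMonomial k) _ x :=
    (hx.pow k).mul (((hx.pow 2).neg.div_const 2).cexp)
  rw [h.deriv]
  simp only [sub_apply, smul_apply, hermiteMonomial_apply,
    Pi.pow_apply, Pi.neg_apply, smul_eq_mul]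
  push_cast
  ring

/-- The Hamiltonian `f ↦ (-f'' + x² f) / 2` on Schwartz functions. -/
def schwartzHamiltonian (f : 𝓢(ℝ, ℂ)) : 𝓢(ℝ, ℂ) :=
  (1 / 2 : ℂ) • (-(SchwartzMap.derivCLM ℂ ℂ (SchwartzMap.derivCLM ℂ ℂ f)) +
    SchwartzMap.smulLeftCLM ℂ (fun x : ℝ => (x : ℂ) ^ 2) f)

lemma hasTemperateGrowth_sq : (fun x : ℝ => (x : ℂ) ^ 2).HasTemperateGrowth := by
  have h : (fun x : ℝ => (x : ℂ)).HasTemperateGrowth := Complex.ofRealCLM.hasTemperateGrowth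
  have h2 := h.mul h
  simpa only [pow_two] using! h2

lemma hamiltonian_apply (T : 𝓢'(ℝ, ℂ)) (f : 𝓢(ℝ, ℂ)) :
    hamiltonian T f = T (schwartzHamiltonian f) := by
  have h1 : hamiltonian T f = (1 / 2 : ℂ) *
      (-(TemperedDistribution.derivCLM ℂ (TemperedDistribution.derivCLM ℂ T) f) +
        TemperedDistribution.smulLeftCLM ℂ (fun x : ℝ => (x : ℂ) ^ 2) T f) := rfl
  rw [h1, TemperedDistribution.derivCLM_apply_apply, TemperedDistribution.derivCLM_apply_apply,
    TemperedDistribution.smulLeftCLM_apply_apply, schwartzHamiltonian]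
  simp only [map_neg, map_smul, map_add, smul_eq_mul, neg_neg]

lemma schwartzHamiltonian_hermiteMonomial (k : ℕ) :
    schwartzHamiltonian (hermiteMonomial k) =
      ((k : ℂ) + 1 / 2) • hermiteMonomial k -
        ((k : ℂ) * ((k - 1 : ℕ) : ℂ) / 2) • hermiteMonomial (k - 2) := by
  have hk : (k : ℂ) • hermiteMonomial (k - 1 + 1) = (k : ℂ) • hermiteMonomial k := by
    rcases k with _ | k
    · simp
    · rfl
  have hsq : SchwartzMap.smulLeftCLM ℂ (fun x : ℝ => (x : ℂ) ^ 2) (hermiteMonomial k) =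
      hermiteMonomial (k + 2) := by
    ext x
    rw [SchwartzMap.smulLeftCLM_apply_apply hasTemperateGrowth_sq]
    simp only [hermiteMonomial_apply, smul_eq_mul]
    ring
  rw [schwartzHamiltonian, hsq, deriv_hermiteMonomial, map_sub, map_smul, deriv_hermiteMonomial,
    deriv_hermiteMonomial, smul_sub, hk]
  simp only [Nat.add_sub_cancel]
  push_cast
  module

/-- Weak solutions with the same datum agree on `x^k e^{-x²/2}`: the equation becomes a triangular
system of ordinary differential equations for the moments. -/
lemma apply_hermiteMonomial_eq {Y : ℝ → ℂ} {u v : ℝ → 𝓢'(ℝ, ℂ)} (hu : SolvesCauchyProblem Y u)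
    (hv : SolvesCauchyProblem Y v) (k : ℕ) {t : ℝ} (ht : 0 ≤ t) :
    u t (hermiteMonomial k) = v t (hermiteMonomial k) := by
  induction k using Nat.strong_induction_on generalizing t with
  | _ k ih =>
    set c : ℂ := (k : ℂ) + 1 / 2 with hc
    set w : ℝ → ℂ := fun s => u s (hermiteMonomial k) - v s (hermiteMonomial k) with hw
    have hlow : ∀ s : ℝ, 0 ≤ s → ((k : ℂ) * ((k - 1 : ℕ) : ℂ) / 2) * u s (hermiteMonomial (k - 2)) =
        ((k : ℂ) * ((k - 1 : ℕ) : ℂ) / 2) * v s (hermiteMonomial (k - 2)) := by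
      intro s hs
      rcases k with _ | _ | k
      · simp
      · simp
      · rw [ih _ (by omega) hs]
    have hder : ∀ s : ℝ, 0 ≤ s → HasDerivWithinAt w (-Complex.I * c * w s) (Set.Ici 0) s := by
      intro s hs
      obtain ⟨d, hd, hd'⟩ := hu.2 (hermiteMonomial k) s hs
      obtain ⟨e, he, he'⟩ := hv.2 (hermiteMonomial k) s hs
      refine (hd.sub he).congr_deriv ?_
      rw [hamiltonian_apply, schwartzHamiltonian_hermiteMonomial, map_sub, map_smul, map_smul,
        smul_eq_mul, smul_eq_mul] at hd' he'
      have hI := Complex.I_mul_I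
      simp only [hw]
      linear_combination (-Complex.I) * hd' + Complex.I * he' + (d - e) * hI +
        Complex.I * hlow s hs
    have hconst : ∀ s ∈ Set.Icc 0 t, Complex.exp (Complex.I * c * s) * w s =
        Complex.exp (Complex.I * c * (0 : ℝ)) * w 0 := by
      have hder2 : ∀ s : ℝ, 0 ≤ s → HasDerivWithinAt
          (fun s : ℝ => Complex.exp (Complex.I * c * s) * w s) 0 (Set.Ici 0) s := by
        intro s hs
        have h1 : HasDerivAt (fun s : ℝ => (s : ℂ)) 1 s := Complex.ofRealCLM.hasDerivAt
        refine ((h1.const_mul (Complex.I * c)).cexp.hasDerivWithinAt.mul (hder s hs)).congr_deriv ?_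
        ring
      refine constant_of_has_deriv_right_zero (fun s hs => ?_) fun s hs => ?_
      · exact (hder2 s hs.1).continuousWithinAt.mono Set.Icc_subset_Ici_self
      · exact (hder2 s hs.1).mono (Set.Ici_subset_Ici.2 hs.1)
    have h0 : w 0 = 0 := by
      simp only [hw]
      rw [hu.1, hv.1, sub_self]
    have h := hconst t ⟨ht, le_rfl⟩
    rw [h0, mul_zero] at h
    exact sub_eq_zero.1 ((mul_eq_zero.1 h).resolve_left (Complex.exp_ne_zero _))

/-! ### Density of the Hermite functions -/

/-- Doubling the exponent makes the Taylor remainder of the exponential geometrically small. -/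
lemma norm_exp_sub_sum_le_geometric (w : ℂ) (n : ℕ) :
    ‖Complex.exp w - ∑ k ∈ Finset.range n, w ^ k / k.factorial‖ ≤
      (1 / 2) ^ n * Real.exp (2 * ‖w‖) := by
  refine (Complex.norm_exp_sub_sum_le_exp_norm_sub_sum w n).trans ?_
  have hexp : ∀ r : ℝ, HasSum (fun k : ℕ => r ^ k / k.factorial) (Real.exp r) := fun r => by
    rw [Real.exp_eq_exp_ℝ]
    exact NormedSpace.expSeries_div_hasSum_exp r
  have h1 := (hexp ‖w‖).summable.sum_add_tsum_nat_add n
  rw [(hexp ‖w‖).tsum_eq] at h1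
  have h2 := (hexp (2 * ‖w‖)).summable.sum_add_tsum_nat_add n
  rw [(hexp (2 * ‖w‖)).tsum_eq] at h2
  have hs1 := (summable_nat_add_iff n).2 (hexp ‖w‖).summable
  have hs2 := (summable_nat_add_iff n).2 (hexp (2 * ‖w‖)).summable
  have h3 : ∑' k : ℕ, ‖w‖ ^ (k + n) / (k + n).factorial ≤
      (1 / 2) ^ n * ∑' k : ℕ, (2 * ‖w‖) ^ (k + n) / (k + n).factorial := by
    rw [← tsum_mul_left]
    refine hs1.tsum_le_tsum (fun k => ?_) (hs2.mul_left _)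
    have h4 : (1 / 2 : ℝ) ^ n * (2 * ‖w‖) ^ (k + n) = 2 ^ k * ‖w‖ ^ (k + n) := by
      rw [mul_pow, pow_add 2 k n, div_pow, one_pow]
      field_simp
    rw [← mul_div_assoc, h4]
    gcongr
    exact le_mul_of_one_le_left (by positivity) (one_le_pow₀ one_le_two)
  have h5 : 0 ≤ ∑ k ∈ Finset.range n, (2 * ‖w‖) ^ k / k.factorial :=
    Finset.sum_nonneg fun k _ => by positivity
  have h6 : (1 / 2 : ℝ) ^ n * ∑' k : ℕ, (2 * ‖w‖) ^ (k + n) / (k + n).factorial ≤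
      (1 / 2) ^ n * Real.exp (2 * ‖w‖) := by
    gcongr
    linarith
  linarith

/-- A band-limited function times `e^{-x²/2}` is a limit of polynomials times `e^{-x²/2}`: the
Taylor polynomials of its entire extension converge geometrically on the strip `|Im z| ≤ 1`, up to
an exponential weight that the Gaussian absorbs. -/
lemma exists_tendsto_gaussian_mul_fourier {h : 𝓢(ℝ, ℂ)} (hh : HasCompactSupport h) :
    ∃ a : ℕ → ℂ, Tendsto (fun n => ∑ k ∈ Finset.range n, a k • hermiteMonomial k) atTop
      (𝓝 (SchwartzMap.smulLeftCLM ℂ (hermiteMonomial 0) (𝓕 h))) := by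
  obtain ⟨R, hR⟩ := hh.isCompact.isBounded.subset_closedBall (0 : ℝ)
  have hR' : ∀ ξ : ℝ, h ξ ≠ 0 → |ξ| ≤ |R| := fun ξ hξ => by
    have := hR (subset_tsupport _ hξ)
    rw [mem_closedBall_zero_iff, Real.norm_eq_abs] at this
    exact this.trans (le_abs_self R)
  set A : ℝ := 2 * (2 * Real.pi * |R|) with hA
  have hA0 : 0 ≤ A := by positivity
  set a : ℕ → ℂ := fun k => ∫ ξ : ℝ, h ξ * (-(2 * Real.pi * Complex.I * ξ)) ^ k / k.factorial
    with ha
  set H : ℂ → ℂ := fun z => ∫ ξ : ℝ, h ξ * Complex.exp (-(2 * Real.pi * Complex.I * ξ) * z) with hH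
  set P : ℕ → ℂ → ℂ := fun n z => ∑ k ∈ Finset.range n, a k * z ^ k with hP
  set M : ℝ := ∫ ξ : ℝ, ‖h ξ‖ with hM
  have hM0 : 0 ≤ M := MeasureTheory.integral_nonneg fun ξ => norm_nonneg _
  have hint : ∀ f : ℝ → ℂ, Continuous f → MeasureTheory.Integrable fun ξ => h ξ * f ξ :=
    fun f hf => (h.continuous.mul hf).integrable_of_hasCompactSupport hh.mul_right
  have hbound : ∀ n z, ‖H z - P n z‖ ≤ (1 / 2) ^ n * M * Real.exp (A * ‖z‖) := by
    intro n z
    have e1 : P n z = ∫ ξ : ℝ, h ξ * ∑ k ∈ Finset.range n,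
        (-(2 * Real.pi * Complex.I * ξ) * z) ^ k / k.factorial := by
      simp only [hP, ha, Finset.mul_sum]
      rw [MeasureTheory.integral_finsetSum _ fun k _ => hint _ (by fun_prop)]
      refine Finset.sum_congr rfl fun k _ => ?_
      rw [← MeasureTheory.integral_mul_const]
      congr 1
      funext ξ
      rw [mul_pow]
      ring
    rw [e1, hH]
    simp only
    rw [← MeasureTheory.integral_sub (hint _ (by fun_prop)) (hint _ (by fun_prop))]
    have e2 : (1 / 2) ^ n * M * Real.exp (A * ‖z‖) =
        ∫ ξ : ℝ, ‖h ξ‖ * ((1 / 2) ^ n * Real.exp (A * ‖z‖)) := by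
      rw [MeasureTheory.integral_mul_const]
      ring
    rw [e2]
    refine MeasureTheory.norm_integral_le_of_norm_le (h.integrable.norm.mul_const _)
      (Eventually.of_forall fun ξ => ?_)
    rw [← mul_sub, norm_mul]
    by_cases hξ : h ξ = 0
    · simp [hξ]
    refine mul_le_mul_of_nonneg_left ((norm_exp_sub_sum_le_geometric _ n).trans ?_) (norm_nonneg _)
    have hw : ‖-(2 * Real.pi * Complex.I * ξ) * z‖ = 2 * Real.pi * |ξ| * ‖z‖ := by
      simp [abs_of_pos Real.pi_pos]
    have h1 := hR' ξ hξ
    have h2 : 2 * (2 * Real.pi * |ξ| * ‖z‖) = 2 * (2 * Real.pi * |ξ|) * ‖z‖ := by ring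
    rw [hw, hA, h2]
    gcongr
  have hpow : Tendsto (fun n : ℕ => (1 / 2 : ℝ) ^ n) atTop (𝓝 0) :=
    tendsto_pow_atTop_nhds_zero_of_lt_one (by norm_num) (by norm_num)
  have hHd : Differentiable ℂ H := by
    rw [← differentiableOn_univ]
    refine TendstoLocallyUniformlyOn.differentiableOn (F := P) (φ := atTop) ?_
      (Eventually.of_forall fun n => ?_) isOpen_univ
    · rw [tendstoLocallyUniformlyOn_iff_forall_isCompact isOpen_univ]
      intro K _ hK
      obtain ⟨r, hr⟩ := hK.isBounded.subset_closedBall (0 : ℂ)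
      rw [Metric.tendstoUniformlyOn_iff]
      intro ε hε
      have hlim : Tendsto (fun n : ℕ => (1 / 2 : ℝ) ^ n * M * Real.exp (A * r)) atTop (𝓝 0) := by
        simpa using (hpow.mul_const M).mul_const (Real.exp (A * r))
      filter_upwards [hlim.eventually_lt_const hε] with n hn z hz
      rw [dist_eq_norm]
      refine lt_of_le_of_lt ((hbound n z).trans ?_) hn
      have := hr hz
      rw [mem_closedBall_zero_iff] at this
      gcongr
    · simp only [hP]
      fun_prop
  refine ⟨a, tendsto_schwartz_of_seminorm_le hpow fun k m => ?_⟩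
  refine ⟨(k.factorial * m.factorial * Real.exp 1) *
    (M * Real.exp ((A + 1) ^ 2 / 2 + A + 1 / 2)), fun n x => ?_⟩
  have hQd : Differentiable ℂ fun z : ℂ => (P n z - H z) * Complex.exp (-z ^ 2 / 2) := by
    have : Differentiable ℂ (P n) := by
      simp only [hP]
      fun_prop
    fun_prop
  have hfun : ⇑(∑ k ∈ Finset.range n, a k • hermiteMonomial k -
      SchwartzMap.smulLeftCLM ℂ (hermiteMonomial 0) (𝓕 h) : 𝓢(ℝ, ℂ)) =
      fun x : ℝ => (P n x - H x) * Complex.exp (-(x : ℂ) ^ 2 / 2) := by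
    funext y
    have hF : (𝓕 h : 𝓢(ℝ, ℂ)) y = H y := by
      rw [SchwartzMap.fourier_coe, Real.fourier_real_eq_integral_exp_smul]
      simp only [hH]
      congr 1
      funext ξ
      rw [smul_eq_mul, mul_comm]
      congr 2
      push_cast
      ring
    rw [sub_apply, SchwartzMap.smulLeftCLM_apply_apply (hermiteMonomial 0).hasTemperateGrowth, hF,
      sum_apply]
    simp only [smul_apply, hermiteMonomial_apply, hP, smul_eq_mul, pow_zero, one_mul]
    rw [sub_mul, Finset.sum_mul, mul_comm (H y)]
    congr 1
    exact Finset.sum_congr rfl fun k _ => by ring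
  rw [hfun]
  refine (pow_mul_norm_iteratedDeriv_le hQd
    (ε := (1 / 2) ^ n * M * Real.exp ((A + 1) ^ 2 / 2 + A + 1 / 2)) (fun z hz => ?_) k m x).trans
    (le_of_eq (by ring))
  rw [norm_mul, norm_sub_rev]
  calc ‖H z - P n z‖ * ‖Complex.exp (-z ^ 2 / 2)‖
      ≤ (1 / 2) ^ n * M * Real.exp (A * ‖z‖) * ‖Complex.exp (-z ^ 2 / 2)‖ := by
        gcongr
        exact hbound n z
    _ = (1 / 2) ^ n * M * (Real.exp (A * ‖z‖) * ‖Complex.exp (-z ^ 2 / 2)‖) := by ring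
    _ ≤ (1 / 2) ^ n * M * (Real.exp ((A + 1) ^ 2 / 2 + A + 1 / 2) * Real.exp (-|z.re|)) := by
        exact mul_le_mul_of_nonneg_left (exp_mul_norm_exp_neg_sq_le hA0 z hz) (by positivity)
    _ = _ := by ring

/-- A tempered distribution that vanishes on the Hermite functions vanishes. -/
lemma eq_zero_of_apply_hermiteMonomial (T : 𝓢'(ℝ, ℂ)) (hT : ∀ k, T (hermiteMonomial k) = 0)
    (f : 𝓢(ℝ, ℂ)) : T f = 0 := by
  have hTc : Continuous T := T.continuous
  have h1 : ∀ h : 𝓢(ℝ, ℂ), HasCompactSupport h →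
      T (SchwartzMap.smulLeftCLM ℂ (hermiteMonomial 0) (𝓕 h)) = 0 := by
    intro h hh
    obtain ⟨a, ha⟩ := exists_tendsto_gaussian_mul_fourier hh
    refine tendsto_nhds_unique ((hTc.tendsto _).comp ha) ?_
    have : (T ∘ fun n => ∑ k ∈ Finset.range n, a k • hermiteMonomial k) = fun _ => 0 := by
      funext n
      simp [map_sum, hT]
    rw [this]
    exact tendsto_const_nhds
  have h2 : ∀ h : 𝓢(ℝ, ℂ), T (SchwartzMap.smulLeftCLM ℂ (hermiteMonomial 0) (𝓕 h)) = 0 := by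
    have hc : Continuous fun h : 𝓢(ℝ, ℂ) =>
        T (SchwartzMap.smulLeftCLM ℂ (hermiteMonomial 0) (𝓕 h)) :=
      hTc.comp ((ContinuousLinearMap.continuous _).comp
        (FourierTransform.fourierCLM ℂ 𝓢(ℝ, ℂ)).continuous)
    exact fun h => congrFun
      (hc.ext_on dense_hasCompactSupport continuous_const fun h hh => h1 h hh) h
  have h3 : ∀ g : 𝓢(ℝ, ℂ), HasCompactSupport g → T g = 0 := by
    intro g hg
    have hcs : HasCompactSupport fun x : ℝ => Complex.exp ((x : ℂ) ^ 2 / 2) * g x := hg.mul_left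
    have hcd : ContDiff ℝ ∞ fun x : ℝ => Complex.exp ((x : ℂ) ^ 2 / 2) * g x :=
      (contDiff_comp_ofReal (Q := fun z => Complex.exp (z ^ 2 / 2)) (by fun_prop)).mul (g.smooth ⊤)
    have h := h2 (𝓕⁻ (hcs.toSchwartzMap hcd))
    rw [FourierTransform.fourier_fourierInv_eq] at h
    convert h using 2
    ext x
    rw [SchwartzMap.smulLeftCLM_apply_apply (hermiteMonomial 0).hasTemperateGrowth,
      hermiteMonomial_apply]
    have : (hcs.toSchwartzMap hcd) x = Complex.exp ((x : ℂ) ^ 2 / 2) * g x := rfl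
    rw [this, smul_eq_mul, pow_zero, one_mul, ← mul_assoc, ← Complex.exp_add]
    ring_nf
    simp
  exact congrFun (hTc.ext_on dense_hasCompactSupport continuous_const fun g hg => h3 g hg) f

/-- Uniqueness for the weak Cauchy problem. -/
lemma SolvesCauchyProblem.unique {Y : ℝ → ℂ} {u v : ℝ → 𝓢'(ℝ, ℂ)} (hu : SolvesCauchyProblem Y u)
    (hv : SolvesCauchyProblem Y v) {t : ℝ} (ht : 0 ≤ t) (f : 𝓢(ℝ, ℂ)) : u t f = v t f := by
  refine sub_eq_zero.1 (eq_zero_of_apply_hermiteMonomial (u t - v t) (fun k => ?_) f)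
  exact sub_eq_zero.2 (apply_hermiteMonomial_eq hu hv k ht)

lemma EvolvesTo.unique {Y : ℝ → ℂ} {φ ψ : 𝓓'(phaseSpace, ℂ)} (hφ : EvolvesTo Y φ)
    (hψ : EvolvesTo Y ψ) : φ = ψ := by
  obtain ⟨u, hu, hφ⟩ := hφ
  obtain ⟨v, hv, hψ⟩ := hψ
  ext θ
  rw [(hφ θ).2, (hψ θ).2]
  exact MeasureTheory.setIntegral_congr_fun measurableSet_Ioi fun t ht =>
    hu.unique hv (le_of_lt ht) _

/-! ### Fresnel integrals -/

lemma norm_exp_I_mul_ofReal (r : ℝ) : ‖Complex.exp (Complex.I * r)‖ = 1 := by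
  rw [mul_comm, Complex.norm_exp_ofReal_mul_I]

/-- Parseval's formula for a Gaussian with a linear phase. -/
lemma integral_gaussian_mul_fourier {b : ℂ} (hb : 0 < b.re) (c : ℝ) (q : 𝓢(ℝ, ℂ)) :
    ∫ x : ℝ, Complex.exp (-b * (x : ℂ) ^ 2 + Complex.I * c * x) * (𝓕 q : 𝓢(ℝ, ℂ)) x =
      (Real.pi / b) ^ (1 / 2 : ℂ) *
        ∫ ξ : ℝ, Complex.exp (-(((c - 2 * Real.pi * ξ) ^ 2 : ℝ) : ℂ) / (4 * b)) * q ξ := by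
  have hint : Integrable fun x : ℝ => Complex.exp (-b * (x : ℂ) ^ 2 + Complex.I * c * x) := by
    simpa using integrable_cexp_quadratic hb (Complex.I * c) 0
  have h := VectorFourier.integral_fourierIntegral_smul_eq_flip (L := innerₗ ℝ)
    (μ := MeasureTheory.volume) (ν := MeasureTheory.volume) Real.continuous_fourierChar
    continuous_inner hint q.integrable
  have e1 : ∀ x : ℝ, VectorFourier.fourierIntegral Real.fourierChar MeasureTheory.volume
      (innerₗ ℝ).flip q x = (𝓕 q : 𝓢(ℝ, ℂ)) x := by
    intro x
    rw [flip_innerₗ]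
    rfl
  have e2 : ∀ ξ : ℝ, VectorFourier.fourierIntegral Real.fourierChar MeasureTheory.volume
      (innerₗ ℝ) (fun x : ℝ => Complex.exp (-b * (x : ℂ) ^ 2 + Complex.I * c * x)) ξ =
      (Real.pi / b) ^ (1 / 2 : ℂ) *
        Complex.exp (-(((c - 2 * Real.pi * ξ) ^ 2 : ℝ) : ℂ) / (4 * b)) := by
    intro ξ
    have e3 : VectorFourier.fourierIntegral Real.fourierChar MeasureTheory.volume
        (innerₗ ℝ) (fun x : ℝ => Complex.exp (-b * (x : ℂ) ^ 2 + Complex.I * c * x)) ξ =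
        𝓕 (fun x : ℝ => Complex.exp (-b * (x : ℂ) ^ 2 + Complex.I * c * x)) ξ := rfl
    rw [e3, Real.fourier_real_eq_integral_exp_smul]
    have e4 := integral_cexp_quadratic (b := -b) (by simpa using hb)
      (Complex.I * c - 2 * Real.pi * Complex.I * ξ) 0
    rw [neg_neg] at e4
    convert e4 using 1
    · congr 1
      funext x
      rw [smul_eq_mul, ← Complex.exp_add]
      congr 1
      push_cast
      ring
    · congr 2
      push_cast
      have hI := Complex.I_sq
      have h5 : (Complex.I * c - 2 * Real.pi * Complex.I * ξ) ^ 2 =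
          -((c : ℂ) - 2 * Real.pi * ξ) ^ 2 := by
        linear_combination ((c : ℂ) - 2 * Real.pi * ξ) ^ 2 * hI
      rw [h5]
      ring
  simp only [e1, e2, smul_eq_mul] at h
  rw [← h, ← MeasureTheory.integral_const_mul]
  congr 1
  funext ξ
  ring

lemma exp_re_nonpos_le {w : ℂ} (h : w.re ≤ 0) : ‖Complex.exp w‖ ≤ 1 := by
  rw [Complex.norm_exp]
  exact Real.exp_le_one_iff.2 h

/-- Parseval's formula for the oscillating Gaussian `e^{-iβx²}`, as the limit of the one for
Gaussians with a positive real part. -/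
lemma integral_fresnel_mul_fourier {β : ℝ} (hβ : β ≠ 0) (c : ℝ) (q : 𝓢(ℝ, ℂ)) :
    ∫ x : ℝ, Complex.exp (-(Complex.I * β) * (x : ℂ) ^ 2 + Complex.I * c * x) *
        (𝓕 q : 𝓢(ℝ, ℂ)) x =
      (Real.pi / (Complex.I * β)) ^ (1 / 2 : ℂ) *
        ∫ ξ : ℝ, Complex.exp (Complex.I * (((c - 2 * Real.pi * ξ) ^ 2 / (4 * β) : ℝ) : ℂ)) *
          q ξ := by
  have hβ' : (β : ℂ) ≠ 0 := by exact_mod_cast hβ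
  have hden : Complex.I * (β : ℂ) ≠ 0 := mul_ne_zero Complex.I_ne_zero hβ'
  have hb : Tendsto (fun δ : ℝ => (δ : ℂ) + Complex.I * β) (𝓝[>] 0) (𝓝 (Complex.I * β)) := by
    have h : Continuous fun δ : ℝ => (δ : ℂ) + Complex.I * β := by fun_prop
    have h2 := h.tendsto 0
    rw [Complex.ofReal_zero, zero_add] at h2
    exact tendsto_nhdsWithin_of_tendsto_nhds h2
  have hre : ∀ δ : ℝ, ((δ : ℂ) + Complex.I * β).re = δ := fun δ => by simp
  have hpos : ∀ᶠ δ : ℝ in 𝓝[>] 0, 0 < δ := self_mem_nhdsWithin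
  have hL : Tendsto (fun δ : ℝ => ∫ x : ℝ, Complex.exp (-((δ : ℂ) + Complex.I * β) * (x : ℂ) ^ 2 +
      Complex.I * c * x) * (𝓕 q : 𝓢(ℝ, ℂ)) x) (𝓝[>] 0)
      (𝓝 (∫ x : ℝ, Complex.exp (-(Complex.I * β) * (x : ℂ) ^ 2 + Complex.I * c * x) *
        (𝓕 q : 𝓢(ℝ, ℂ)) x)) := by
    refine MeasureTheory.tendsto_integral_filter_of_dominated_convergence
      (fun x => ‖(𝓕 q : 𝓢(ℝ, ℂ)) x‖) (Eventually.of_forall fun δ => ?_) ?_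
      (𝓕 q : 𝓢(ℝ, ℂ)).integrable.norm (Eventually.of_forall fun x => ?_)
    · exact (Continuous.mul (by fun_prop) (𝓕 q : 𝓢(ℝ, ℂ)).continuous).aestronglyMeasurable
    · filter_upwards [hpos] with δ hδ
      refine Eventually.of_forall fun x => ?_
      rw [norm_mul]
      refine mul_le_of_le_one_left (norm_nonneg _) (exp_re_nonpos_le ?_)
      have : (-((δ : ℂ) + Complex.I * β) * (x : ℂ) ^ 2 + Complex.I * c * x).re = -(δ * x ^ 2) := by
        have h2 : -((δ : ℂ) + Complex.I * β) * (x : ℂ) ^ 2 + Complex.I * c * x =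
            ((-(δ * x ^ 2) : ℝ) : ℂ) + Complex.I * ((-(β * x ^ 2) + c * x : ℝ) : ℂ) := by
          push_cast
          ring
        rw [h2, Complex.add_re, Complex.ofReal_re, Complex.re_mul_ofReal, Complex.I_re, zero_mul,
          add_zero]
      rw [this]
      have := sq_nonneg x
      nlinarith
    · exact (((hb.neg.mul_const _).add_const _).cexp).mul_const _
  have hR : Tendsto (fun δ : ℝ => ((Real.pi : ℂ) / ((δ : ℂ) + Complex.I * β)) ^ (1 / 2 : ℂ) *
      ∫ ξ : ℝ, Complex.exp (-(((c - 2 * Real.pi * ξ) ^ 2 : ℝ) : ℂ) /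
        (4 * ((δ : ℂ) + Complex.I * β))) * q ξ) (𝓝[>] 0)
      (𝓝 ((Real.pi / (Complex.I * β)) ^ (1 / 2 : ℂ) *
        ∫ ξ : ℝ, Complex.exp (-(((c - 2 * Real.pi * ξ) ^ 2 : ℝ) : ℂ) /
          (4 * (Complex.I * β))) * q ξ)) := by
    refine Tendsto.mul ?_ ?_
    · have hslit : (Real.pi : ℂ) / (Complex.I * β) ∈ Complex.slitPlane := by
        right
        have : (Real.pi : ℂ) / (Complex.I * β) = ((-(Real.pi / β) : ℝ) : ℂ) * Complex.I := by
          push_cast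
          field_simp
          linear_combination Complex.I_sq
        rw [this]
        simp [hβ, Real.pi_ne_zero]
      exact ((tendsto_const_nhds.div hb hden).cpow tendsto_const_nhds hslit)
    · refine MeasureTheory.tendsto_integral_filter_of_dominated_convergence
        (fun x => ‖q x‖) (Eventually.of_forall fun δ => ?_) ?_ q.integrable.norm
        (Eventually.of_forall fun ξ => ?_)
      · exact (Continuous.mul (by fun_prop) q.continuous).aestronglyMeasurable
      · filter_upwards [hpos] with δ hδ
        refine Eventually.of_forall fun ξ => ?_
        rw [norm_mul]
        refine mul_le_of_le_one_left (norm_nonneg _) (exp_re_nonpos_le ?_)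
        have h1 : -(((c - 2 * Real.pi * ξ) ^ 2 : ℝ) : ℂ) / (4 * ((δ : ℂ) + Complex.I * β)) =
            ((-((c - 2 * Real.pi * ξ) ^ 2 / 4) : ℝ) : ℂ) * ((δ : ℂ) + Complex.I * β)⁻¹ := by
          push_cast
          rw [div_eq_mul_inv, mul_inv]
          ring
        rw [h1, Complex.re_ofReal_mul, Complex.inv_re, hre]
        refine mul_nonpos_of_nonpos_of_nonneg ?_ (div_nonneg hδ.le (Complex.normSq_nonneg _))
        have := sq_nonneg (c - 2 * Real.pi * ξ)
        linarith
      · refine ((tendsto_const_nhds.div (hb.const_mul 4) ?_).cexp).mul_const _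
        exact mul_ne_zero (by norm_num) hden
  have heq := tendsto_nhds_unique (hL.congr' ?_) hR
  · rw [heq]
    congr 2
    funext ξ
    congr 2
    push_cast
    field_simp
    rw [Complex.I_sq]
    ring
  · filter_upwards [hpos] with δ hδ
    exact integral_gaussian_mul_fourier (by rw [hre]; exact hδ) c q

/-! ### The solution of the Cauchy problem -/

lemma norm_wave (l t x : ℝ) :
    ‖wave l (t, x)‖ = Real.exp (-(1 / 2) * Real.log (Real.cos t)) := by
  have h : wavePhase l (t, x) = ((-(1 / 2) * Real.log (Real.cos t) : ℝ) : ℂ) +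
      Complex.I * ((-(Real.pi / 2) * maslovIndex t - (x ^ 2 + l ^ 2) * Real.tan t / 2 +
        l * x * (Real.cos t)⁻¹ : ℝ) : ℂ) := by
    simp only [wavePhase]
    push_cast
    ring
  rw [wave, h, Complex.exp_add, norm_mul, norm_exp_I_mul_ofReal, mul_one, Complex.norm_exp,
    Complex.ofReal_re]

lemma continuous_wave_snd (l : ℂ) (t : ℝ) : Continuous fun x : ℝ => wave l (t, x) :=
  continuous_iff_continuousAt.2 fun x => (hasDerivAt_wave_snd l t x).continuousAt

lemma memLp_wave_snd (l t : ℝ) :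
    MeasureTheory.MemLp (fun x : ℝ => wave l (t, x)) ⊤ MeasureTheory.volume :=
  MeasureTheory.memLp_top_of_bound (continuous_wave_snd l t).aestronglyMeasurable
    (Real.exp (-(1 / 2) * Real.log (Real.cos t)))
    (Eventually.of_forall fun x => (norm_wave l t x).le)

/-- The weight of the point mass to which a wave is focused at a caustic. -/
def causticWeight (t : ℝ) : ℂ :=
  Complex.exp (((1 / 2) * Real.log (2 * Real.pi) : ℝ) +
    (-(Complex.I * Real.pi / 2) * (maslovIndex t : ℂ) + Complex.I * Real.pi / 4))

/-- The state at time `t` evolved from `e^{iλx}`: the wave off the caustics, a point mass at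
`λ sin t = ± λ` on them. -/
def evolution (l t : ℝ) : 𝓢'(ℝ, ℂ) :=
  open scoped Classical in
  if Real.cos t = 0 then causticWeight t • TemperedDistribution.delta (l * Real.sin t)
  else MeasureTheory.Lp.toTemperedDistribution (memLp_wave_snd l t).toLp

lemma evolution_apply_of_cos_eq_zero (l : ℝ) {t : ℝ} (ht : Real.cos t = 0) (f : 𝓢(ℝ, ℂ)) :
    evolution l t f = causticWeight t * f (l * Real.sin t) := by
  rw [evolution, if_pos ht]
  rfl

lemma evolution_apply_of_cos_ne_zero (l : ℝ) {t : ℝ} (ht : Real.cos t ≠ 0) (f : 𝓢(ℝ, ℂ)) :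
    evolution l t f = ∫ x : ℝ, wave l (t, x) * f x := by
  rw [evolution, if_neg ht, MeasureTheory.Lp.toTemperedDistribution_apply]
  refine MeasureTheory.integral_congr_ae ?_
  filter_upwards [(memLp_wave_snd l t).coeFn_toLp] with x hx
  rw [hx, smul_eq_mul, mul_comm]

/-! ### Continuity at the caustics -/

/-- The representation of the evolved state on the Fourier side, which is regular at the caustics.
The integer `m` is the Maslov index at the caustic. -/
def fourierEvolution (l : ℝ) (m : ℤ) (q : 𝓢(ℝ, ℂ)) (t : ℝ) : ℂ :=
  Complex.exp (((1 / 2) * Real.log (2 * Real.pi) - (1 / 2) * Real.log (Real.sin t) : ℝ) +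
    (-(Complex.I * Real.pi / 2) * (m : ℂ) + Complex.I * Real.pi / 4)) *
    ∫ ξ : ℝ, Complex.exp (Complex.I * (((l ^ 2 * (Real.cos t / Real.sin t) -
      4 * Real.pi * ξ * l * (Real.sin t)⁻¹ +
        4 * Real.pi ^ 2 * ξ ^ 2 * (Real.cos t / Real.sin t)) / 2 : ℝ) : ℂ)) * q ξ

lemma continuousAt_fourierEvolution (l : ℝ) (m : ℤ) (q : 𝓢(ℝ, ℂ)) {t : ℝ}
    (ht : Real.sin t ≠ 0) : ContinuousAt (fourierEvolution l m q) t := by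
  have hlog : ContinuousAt (fun s => Real.log (Real.sin s)) t :=
    (Real.continuous_sin.continuousAt).log ht
  have hcot : ContinuousAt (fun s => Real.cos s / Real.sin s) t :=
    Real.continuous_cos.continuousAt.div Real.continuous_sin.continuousAt ht
  have hinv : ContinuousAt (fun s => (Real.sin s)⁻¹) t := Real.continuous_sin.continuousAt.inv₀ ht
  refine ContinuousAt.mul ?_ ?_
  · refine ContinuousAt.cexp (ContinuousAt.add ?_ continuousAt_const)
    exact Complex.continuous_ofReal.continuousAt.comp
      (continuousAt_const.sub (continuousAt_const.mul hlog))
  · refine MeasureTheory.tendsto_integral_filter_of_dominated_convergence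
      (fun x => ‖q x‖) (Eventually.of_forall fun δ => ?_) (Eventually.of_forall fun δ => ?_)
      q.integrable.norm (Eventually.of_forall fun ξ => ?_)
    · exact (Continuous.mul (by fun_prop) q.continuous).aestronglyMeasurable
    · refine Eventually.of_forall fun ξ => ?_
      rw [norm_mul, norm_exp_I_mul_ofReal, one_mul]
    · have : ContinuousAt (fun s => (l ^ 2 * (Real.cos s / Real.sin s) -
          4 * Real.pi * ξ * l * (Real.sin s)⁻¹ +
            4 * Real.pi ^ 2 * ξ ^ 2 * (Real.cos s / Real.sin s)) / 2) t := by fun_prop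
      exact ((Complex.continuous_ofReal.continuousAt.comp this).const_mul
        Complex.I).cexp.mul_const _

lemma pi_div_I_mul {T : ℝ} (hT : T ≠ 0) :
    (Real.pi : ℂ) / (Complex.I * ((T / 2 : ℝ) : ℂ)) =
      ((2 * Real.pi / T : ℝ) : ℂ) * (-Complex.I) := by
  have hT' : (T : ℂ) ≠ 0 := by exact_mod_cast hT
  push_cast
  field_simp
  linear_combination Complex.I_sq

/-- The prefactors of the two representations agree: the Maslov phase absorbs the jump of the
principal square root when `tan t` changes sign. -/
lemma fresnel_prefactor {t : ℝ} (ht : Real.cos t ≠ 0) (hs : Real.sin t ≠ 0) {m : ℤ}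
    (hm : (0 < Real.tan t ∧ maslovIndex t = m - 1) ∨ (Real.tan t < 0 ∧ maslovIndex t = m)) :
    Complex.exp (((-(1 / 2) * Real.log (Real.cos t) : ℝ) : ℂ) +
        -(Complex.I * Real.pi / 2) * (maslovIndex t : ℂ)) *
      (Real.pi / (Complex.I * ((Real.tan t / 2 : ℝ) : ℂ))) ^ (1 / 2 : ℂ) =
    Complex.exp (((1 / 2) * Real.log (2 * Real.pi) - (1 / 2) * Real.log (Real.sin t) : ℝ) +
      (-(Complex.I * Real.pi / 2) * (m : ℂ) + Complex.I * Real.pi / 4)) := by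
  have htan : Real.tan t ≠ 0 := by
    rw [Real.tan_eq_sin_div_cos]
    exact div_ne_zero hs ht
  have htanc : (Real.tan t : ℂ) ≠ 0 := by exact_mod_cast htan
  have h2pi : (2 * Real.pi) ≠ 0 := by positivity
  have hw0 : (Real.pi : ℂ) / (Complex.I * ((Real.tan t / 2 : ℝ) : ℂ)) ≠ 0 := by
    refine div_ne_zero (by exact_mod_cast Real.pi_ne_zero) (mul_ne_zero Complex.I_ne_zero ?_)
    exact_mod_cast div_ne_zero htan two_ne_zero
  have hlogtan : Real.log (Real.tan t) = Real.log (Real.sin t) - Real.log (Real.cos t) := by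
    rw [Real.tan_eq_sin_div_cos, Real.log_div hs ht]
  have hlogdiv : Real.log (2 * Real.pi / Real.tan t) =
      Real.log (2 * Real.pi) - (Real.log (Real.sin t) - Real.log (Real.cos t)) := by
    rw [Real.log_div h2pi htan, hlogtan]
  rw [Complex.cpow_def_of_ne_zero hw0, ← Complex.exp_add]
  congr 1
  rcases hm with ⟨hpos, hm⟩ | ⟨hneg, hm⟩
  · rw [pi_div_I_mul htan, Complex.log_ofReal_mul (by positivity) (neg_ne_zero.2 Complex.I_ne_zero),
      Complex.log_neg_I, hlogdiv, hm]
    push_cast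
    ring
  · have hw : (Real.pi : ℂ) / (Complex.I * ((Real.tan t / 2 : ℝ) : ℂ)) =
        ((-(2 * Real.pi / Real.tan t) : ℝ) : ℂ) * Complex.I := by
      rw [pi_div_I_mul htan, Complex.ofReal_neg, neg_mul, mul_neg]
    have hpos : 0 < -(2 * Real.pi / Real.tan t) :=
      neg_pos.2 (div_neg_of_pos_of_neg (by positivity) hneg)
    rw [hw, Complex.log_ofReal_mul hpos Complex.I_ne_zero, Complex.log_I, Real.log_neg_eq_log,
      hlogdiv, hm]
    push_cast
    ring

/-- The two representations agree on both sides of a caustic with Maslov index `m`: before it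
`tan t > 0` and the index is still `m - 1`, after it `tan t < 0`. -/
lemma evolution_eq_fourierEvolution (l : ℝ) (q : 𝓢(ℝ, ℂ)) {t : ℝ} (ht : Real.cos t ≠ 0)
    (hs : Real.sin t ≠ 0) {m : ℤ}
    (hm : (0 < Real.tan t ∧ maslovIndex t = m - 1) ∨ (Real.tan t < 0 ∧ maslovIndex t = m)) :
    evolution l t (𝓕 q) = fourierEvolution l m q t := by
  have htan : Real.tan t ≠ 0 := by
    rw [Real.tan_eq_sin_div_cos]
    exact div_ne_zero hs ht
  set A : ℂ := Complex.exp (((-(1 / 2) * Real.log (Real.cos t) : ℝ) : ℂ) +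
        -(Complex.I * Real.pi / 2) * (maslovIndex t : ℂ)) with hA
  set E : ℂ := Complex.exp (-(Complex.I / 2) * l ^ 2 * (Real.tan t : ℂ)) with hE
  have hF := integral_fresnel_mul_fourier (β := Real.tan t / 2) (div_ne_zero htan two_ne_zero)
    (l * (Real.cos t)⁻¹) q
  have h1 : evolution l t (𝓕 q) = A * E *
      ∫ x : ℝ, Complex.exp (-(Complex.I * ((Real.tan t / 2 : ℝ) : ℂ)) * (x : ℂ) ^ 2 +
        Complex.I * ((l * (Real.cos t)⁻¹ : ℝ) : ℂ) * x) * (𝓕 q : 𝓢(ℝ, ℂ)) x := by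
    rw [evolution_apply_of_cos_ne_zero l ht, ← MeasureTheory.integral_const_mul]
    congr 1
    funext x
    rw [← mul_assoc, hA, hE, ← Complex.exp_add, ← Complex.exp_add, wave]
    congr 2
    simp only [wavePhase]
    push_cast
    ring
  rw [h1, hF, fourierEvolution, ← fresnel_prefactor ht hs hm]
  rw [mul_assoc, mul_assoc, mul_left_comm E, ← MeasureTheory.integral_const_mul]
  congr 3
  funext ξ
  rw [← mul_assoc, hE, ← Complex.exp_add]
  congr 2
  have hreal : -(1 / 2) * l ^ 2 * Real.tan t +
      (l * (Real.cos t)⁻¹ - 2 * Real.pi * ξ) ^ 2 / (4 * (Real.tan t / 2)) =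
      (l ^ 2 * (Real.cos t / Real.sin t) - 4 * Real.pi * ξ * l * (Real.sin t)⁻¹ +
        4 * Real.pi ^ 2 * ξ ^ 2 * (Real.cos t / Real.sin t)) / 2 := by
    rw [Real.tan_eq_sin_div_cos]
    field_simp
    linear_combination -4 * l ^ 2 * Real.sin_sq_add_cos_sq t
  rw [← hreal]
  push_cast
  ring

lemma sin_sq_eq_one_of_cos_eq_zero {t : ℝ} (ht : Real.cos t = 0) : Real.sin t ^ 2 = 1 := by
  have := Real.sin_sq_add_cos_sq t
  rw [ht] at this
  linarith

/-- At a caustic the quadratic phase vanishes, and the representation is the Fourier integral at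
`λ sin t`. -/
lemma evolution_eq_fourierEvolution_of_cos_eq_zero (l : ℝ) (q : 𝓢(ℝ, ℂ)) {t : ℝ}
    (ht : Real.cos t = 0) :
    evolution l t (𝓕 q) = fourierEvolution l (maslovIndex t) q t := by
  have hsq := sin_sq_eq_one_of_cos_eq_zero ht
  have hs0 : Real.sin t ≠ 0 := fun h => by simp [h] at hsq
  have hinv : (Real.sin t)⁻¹ = Real.sin t := by
    rw [inv_eq_iff_eq_inv, eq_comm, inv_eq_of_mul_eq_one_left]
    rw [← pow_two, hsq]
  have hlog : Real.log (Real.sin t) = 0 := by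
    rcases mul_self_eq_one_iff.1 ((pow_two _).symm.trans hsq) with h | h <;> simp [h]
  rw [evolution_apply_of_cos_eq_zero l ht, fourierEvolution, hlog, ht, hinv, causticWeight]
  congr 2
  · simp
  · rw [SchwartzMap.fourier_coe, Real.fourier_real_eq_integral_exp_smul]
    congr 1
    funext ξ
    rw [smul_eq_mul]
    congr 2
    push_cast
    ring

lemma continuousAt_evolution_of_cos_eq_zero (l : ℝ) (f : 𝓢(ℝ, ℂ)) {t : ℝ}
    (ht : Real.cos t = 0) : ContinuousAt (fun s => evolution l s f) t := by
  have hsq := sin_sq_eq_one_of_cos_eq_zero ht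
  have hs0 : Real.sin t ≠ 0 := fun h => by simp [h] at hsq
  set q : 𝓢(ℝ, ℂ) := 𝓕⁻ f with hq
  have hf : f = 𝓕 q := (FourierTransform.fourier_fourierInv_eq f).symm
  rw [hf]
  refine (continuousAt_fourierEvolution l (maslovIndex t) q hs0).congr_of_eventuallyEq ?_
  -- `t` is the left end of its Maslov interval
  obtain ⟨k, hk⟩ := Real.cos_eq_zero_iff.1 ht
  have hpi := Real.pi_pos
  have hmt : maslovIndex t = k + 1 := by
    rw [maslovIndex_eq_iff]
    push_cast
    constructor <;> linarith
  have hnhds : Set.Ioo (t - Real.pi / 2) (t + Real.pi / 2) ∈ 𝓝 t :=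
    Ioo_mem_nhds (by linarith) (by linarith)
  filter_upwards [hnhds] with s hs
  rcases lt_trichotomy s t with hlt | rfl | hgt
  · have h1 : 0 < s - k * Real.pi := by linarith [hs.1]
    have h2 : s - k * Real.pi < Real.pi / 2 := by linarith
    have htan : 0 < Real.tan s := by
      rw [← Real.tan_periodic.sub_int_mul_eq k]
      exact Real.tan_pos_of_pos_of_lt_pi_div_two h1 h2
    have hne : Real.sin s ≠ 0 ∧ Real.cos s ≠ 0 := by
      rw [Real.tan_eq_sin_div_cos] at htan
      exact div_ne_zero_iff.1 htan.ne'
    refine evolution_eq_fourierEvolution l q hne.2 hne.1 (Or.inl ⟨htan, ?_⟩)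
    rw [hmt, maslovIndex_eq_iff]
    push_cast
    constructor <;> linarith
  · exact evolution_eq_fourierEvolution_of_cos_eq_zero l q ht
  · have h1 : s - ((k + 1 : ℤ) : ℝ) * Real.pi < 0 := by
      push_cast
      linarith [hs.2]
    have h2 : -(Real.pi / 2) < s - ((k + 1 : ℤ) : ℝ) * Real.pi := by
      push_cast
      linarith
    have htan : Real.tan s < 0 := by
      rw [← Real.tan_periodic.sub_int_mul_eq (k + 1)]
      exact Real.tan_neg_of_neg_of_pi_div_two_lt h1 h2
    have hne : Real.sin s ≠ 0 ∧ Real.cos s ≠ 0 := by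
      rw [Real.tan_eq_sin_div_cos] at htan
      exact div_ne_zero_iff.1 htan.ne
    refine evolution_eq_fourierEvolution l q hne.2 hne.1 (Or.inr ⟨htan, ?_⟩)
    rw [hmt, maslovIndex_eq_iff]
    push_cast
    constructor <;> linarith [hs.2]

/-! ### The Schrödinger equation for the evolved state -/

lemma integrable_weight_mul (f : 𝓢(ℝ, ℂ)) : Integrable fun x : ℝ => (1 + x ^ 2) * ‖f x‖ := by
  have h := f.integrable.norm.add (f.integrable_pow_mul MeasureTheory.volume 2)
  refine h.congr (Eventually.of_forall fun x => ?_)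
  simp only [Pi.add_apply, Real.norm_eq_abs, sq_abs]
  ring

lemma integrable_mul_of_le {g : ℝ → ℂ} (hg : Continuous g) {C : ℝ}
    (hC : ∀ x, ‖g x‖ ≤ C * (1 + x ^ 2)) (f : 𝓢(ℝ, ℂ)) : Integrable fun x => g x * f x := by
  refine ((integrable_weight_mul f).const_mul C).mono' (hg.mul f.continuous).aestronglyMeasurable
    (Eventually.of_forall fun x => ?_)
  rw [norm_mul, ← mul_assoc]
  exact mul_le_mul_of_nonneg_right (hC x) (norm_nonneg _)

lemma norm_mul_add_mul_sq_le (a b x y : ℝ) :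
    ‖-(Complex.I * x * a) + Complex.I * y * b‖ ^ 2 ≤ 2 * (a ^ 2 * x ^ 2 + b ^ 2 * y ^ 2) := by
  have h : -(Complex.I * x * a) + Complex.I * y * b = Complex.I * ((y * b - x * a : ℝ) : ℂ) := by
    push_cast
    ring
  rw [h, norm_mul, Complex.norm_I, one_mul, Complex.norm_real, Real.norm_eq_abs, sq_abs]
  nlinarith [sq_nonneg (y * b + x * a)]

/-- The logarithmic `x`-derivative of the wave. -/
def waveSlope (l t x : ℝ) : ℂ :=
  -(Complex.I * x * Real.tan t) + Complex.I * l * ((Real.cos t)⁻¹ : ℝ)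

lemma norm_waveSlope_sq_le {l t B : ℝ} (htan : |Real.tan t| ≤ B) (hsec : |(Real.cos t)⁻¹| ≤ B)
    (x : ℝ) : ‖waveSlope l t x‖ ^ 2 ≤ 2 * B ^ 2 * (1 + l ^ 2) * (1 + x ^ 2) := by
  have h1 : Real.tan t ^ 2 ≤ B ^ 2 := sq_le_sq' (by linarith [neg_abs_le (Real.tan t)])
    ((le_abs_self _).trans htan)
  have h2 : (Real.cos t)⁻¹ ^ 2 ≤ B ^ 2 := sq_le_sq' (by linarith [neg_abs_le (Real.cos t)⁻¹])
    ((le_abs_self _).trans hsec)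
  refine (norm_mul_add_mul_sq_le _ _ x l).trans ?_
  have h3 := mul_le_mul_of_nonneg_right h1 (sq_nonneg x)
  have h4 := mul_le_mul_of_nonneg_right h2 (sq_nonneg l)
  nlinarith [mul_nonneg (sq_nonneg B) (mul_nonneg (sq_nonneg l) (sq_nonneg x)), sq_nonneg B]

lemma continuous_waveSlope (l t : ℝ) : Continuous (waveSlope l t) := by
  unfold waveSlope
  fun_prop

lemma oscOp_wave (l t x : ℝ) : oscOp (wave l) (t, x) = wave l (t, x) *
    (-(waveSlope l t x ^ 2 - Complex.I * Real.tan t) + (x : ℂ) ^ 2) := by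
  rw [oscOp, dx_dx_wave]
  simp only [waveSlope]
  ring

lemma norm_oscOp_wave_le {l t B D : ℝ} (htan : |Real.tan t| ≤ B) (hsec : |(Real.cos t)⁻¹| ≤ B)
    (hD : Real.exp (-(1 / 2) * Real.log (Real.cos t)) ≤ D) (x : ℝ) :
    ‖oscOp (wave l) (t, x)‖ ≤ D * (2 * B ^ 2 * (1 + l ^ 2) + B + 1) * (1 + x ^ 2) := by
  have hB : 0 ≤ B := (abs_nonneg _).trans htan
  rw [oscOp_wave, norm_mul, norm_wave, mul_assoc]
  refine mul_le_mul hD ?_ (norm_nonneg _) ((Real.exp_pos _).le.trans hD)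
  refine (norm_add_le _ _).trans ?_
  rw [norm_neg]
  have h1 := norm_sub_le (waveSlope l t x ^ 2) (Complex.I * Real.tan t)
  have h2 := norm_waveSlope_sq_le (l := l) htan hsec x
  have h3 : ‖Complex.I * (Real.tan t : ℂ)‖ ≤ B := by
    rw [norm_mul, Complex.norm_I, one_mul, Complex.norm_real]
    exact htan
  have h4 : ‖(x : ℂ) ^ 2‖ = x ^ 2 := by
    rw [norm_pow, Complex.norm_real, Real.norm_eq_abs, sq_abs]
  rw [norm_pow] at h1
  rw [h4]
  nlinarith [sq_nonneg x]

lemma continuous_oscOp_wave (l t : ℝ) : Continuous fun x : ℝ => oscOp (wave l) (t, x) := by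
  have h : (fun x : ℝ => oscOp (wave l) (t, x)) = fun x : ℝ => wave l (t, x) *
      (-(waveSlope l t x ^ 2 - Complex.I * Real.tan t) + (x : ℂ) ^ 2) := by
    funext x
    exact oscOp_wave l t x
  rw [h]
  have h1 := continuous_wave_snd l t
  have h2 := continuous_waveSlope l t
  fun_prop

/-- The Hamiltonian may be moved from the wave to the test function. -/
lemma integral_oscOp_wave_mul (l t : ℝ) (f : 𝓢(ℝ, ℂ)) :
    ∫ x : ℝ, oscOp (wave l) (t, x) * f x =
      2 * ∫ x : ℝ, wave l (t, x) * schwartzHamiltonian f x := by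
  set w : ℝ → ℂ := fun x => wave l (t, x) with hw
  set w' : ℝ → ℂ := fun x => wave l (t, x) * waveSlope l t x with hw'
  set w'' : ℝ → ℂ := fun x => wave l (t, x) * (waveSlope l t x ^ 2 - Complex.I * Real.tan t)
    with hw''
  set f' : 𝓢(ℝ, ℂ) := SchwartzMap.derivCLM ℂ ℂ f with hf'
  set f'' : 𝓢(ℝ, ℂ) := SchwartzMap.derivCLM ℂ ℂ f' with hf''
  have hdw : ∀ x, HasDerivAt w (w' x) x := fun x => hasDerivAt_wave_snd l t x
  have hdw' : ∀ x, HasDerivAt w' (w'' x) x := fun x => hasDerivAt_wave_snd_snd l t x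
  have hdf : ∀ x, HasDerivAt f (f' x) x := fun x => f.hasDerivAt x
  have hdf' : ∀ x, HasDerivAt f' (f'' x) x := fun x => f'.hasDerivAt x
  set D : ℝ := Real.exp (-(1 / 2) * Real.log (Real.cos t)) with hD
  have hD0 : 0 < D := Real.exp_pos _
  set B : ℝ := max |Real.tan t| |(Real.cos t)⁻¹| with hB
  have hB1 : |Real.tan t| ≤ B := le_max_left _ _
  have hB2 : |(Real.cos t)⁻¹| ≤ B := le_max_right _ _
  have hB0 : 0 ≤ B := (abs_nonneg _).trans hB1
  have hslope := norm_waveSlope_sq_le (l := l) hB1 hB2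
  have hcw : Continuous w := continuous_wave_snd l t
  have hcs := continuous_waveSlope l t
  have hbw : ∀ x, ‖w x‖ ≤ D * (1 + x ^ 2) := fun x => by
    rw [hw, norm_wave]
    exact le_mul_of_one_le_right hD0.le (by linarith [sq_nonneg x])
  have hbw' : ∀ x, ‖w' x‖ ≤ (D * (1 + 2 * B ^ 2 * (1 + l ^ 2))) * (1 + x ^ 2) := fun x => by
    rw [hw']
    simp only [norm_mul, norm_wave]
    rw [mul_assoc]
    refine mul_le_mul_of_nonneg_left ?_ hD0.le
    nlinarith [hslope x, sq_nonneg (‖waveSlope l t x‖ - 1), sq_nonneg x]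
  have hosc : ∀ x, oscOp (wave l) (t, x) = (x : ℂ) ^ 2 * w x - w'' x := fun x => by
    rw [oscOp_wave, hw, hw'']
    ring
  have hi1 : ∀ g : 𝓢(ℝ, ℂ), Integrable (w * ⇑g) := fun g => integrable_mul_of_le hcw hbw g
  have hi2 : ∀ g : 𝓢(ℝ, ℂ), Integrable (w' * ⇑g) := fun g =>
    integrable_mul_of_le (hcw.mul hcs) hbw' g
  have hio : Integrable fun x => oscOp (wave l) (t, x) * f x :=
    integrable_mul_of_le (continuous_oscOp_wave l t) (norm_oscOp_wave_le hB1 hB2 le_rfl) f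
  have hsq : ∀ x : ℝ, SchwartzMap.smulLeftCLM ℂ (fun x : ℝ => (x : ℂ) ^ 2) f x =
      (x : ℂ) ^ 2 * f x := fun x => by
    rw [SchwartzMap.smulLeftCLM_apply_apply hasTemperateGrowth_sq, smul_eq_mul]
  have hix : Integrable fun x : ℝ => w x * ((x : ℂ) ^ 2 * f x) := by
    refine (hi1 (SchwartzMap.smulLeftCLM ℂ (fun x : ℝ => (x : ℂ) ^ 2) f)).congr
      (Eventually.of_forall fun x => ?_)
    simp only [Pi.mul_apply, hsq]
  have hi3 : Integrable (w'' * ⇑f) := by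
    refine (hix.sub hio).congr (Eventually.of_forall fun x => ?_)
    simp only [Pi.sub_apply, Pi.mul_apply, hosc]
    ring
  have p1 : ∫ x, w x * f'' x = -∫ x, w' x * f' x :=
    MeasureTheory.integral_mul_deriv_eq_deriv_mul_of_integrable (fun x _ => hdw x)
      (fun x _ => hdf' x) (hi1 f'') (hi2 f') (hi1 f')
  have p2 : ∫ x, w' x * f' x = -∫ x, w'' x * f x :=
    MeasureTheory.integral_mul_deriv_eq_deriv_mul_of_integrable (fun x _ => hdw' x)
      (fun x _ => hdf x) (hi2 f') hi3 (hi2 f)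
  have hi3' : Integrable fun x => w'' x * f x := hi3
  have hi1' : Integrable fun x => w x * f'' x := hi1 f''
  have e1 : ∫ x, oscOp (wave l) (t, x) * f x =
      (∫ x : ℝ, w x * ((x : ℂ) ^ 2 * f x)) - ∫ x, w'' x * f x := by
    rw [← MeasureTheory.integral_sub hix hi3']
    congr 1
    funext x
    rw [hosc]
    ring
  have e2 : 2 * ∫ x : ℝ, wave l (t, x) * schwartzHamiltonian f x =
      (∫ x : ℝ, w x * ((x : ℂ) ^ 2 * f x)) - ∫ x, w x * f'' x := by
    rw [← MeasureTheory.integral_sub hix hi1', ← MeasureTheory.integral_const_mul]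
    congr 1
    funext x
    have : schwartzHamiltonian f x = (1 / 2 : ℂ) * (-(f'' x) +
        SchwartzMap.smulLeftCLM ℂ (fun x : ℝ => (x : ℂ) ^ 2) f x) := rfl
    rw [this, hsq, hw]
    ring
  rw [e1, e2, p1, p2, neg_neg]

/-- Differentiation under the integral sign: near `t` the time derivative of the wave is bounded by
a multiple of `1 + x²`. -/
lemma hasDerivAt_evolution_of_cos_ne_zero (l : ℝ) (f : 𝓢(ℝ, ℂ)) {t : ℝ} (ht : Real.cos t ≠ 0) :
    HasDerivAt (fun s => evolution l s f)
      (-Complex.I * evolution l t (schwartzHamiltonian f)) t := by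
  have hcos : ∀ᶠ s in 𝓝 t, Real.cos s ≠ 0 :=
    Real.continuous_cos.continuousAt.eventually_ne ht
  set B : ℝ := max |Real.tan t| |(Real.cos t)⁻¹| + 1 with hB
  set D : ℝ := Real.exp (-(1 / 2) * Real.log (Real.cos t)) + 1 with hD
  have htan : ∀ᶠ s in 𝓝 t, |Real.tan s| < B :=
    ((Real.hasDerivAt_tan ht).continuousAt.abs).eventually_lt_const
      (lt_of_le_of_lt (le_max_left _ _) (lt_add_one _))
  have hsec : ∀ᶠ s in 𝓝 t, |(Real.cos s)⁻¹| < B :=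
    ((Real.continuous_cos.continuousAt.inv₀ ht).abs).eventually_lt_const
      (lt_of_le_of_lt (le_max_right _ _) (lt_add_one _))
  have hexp : ∀ᶠ s in 𝓝 t, Real.exp (-(1 / 2) * Real.log (Real.cos s)) < D := by
    have h : ContinuousAt (fun s => Real.exp (-(1 / 2) * Real.log (Real.cos s))) t :=
      Real.continuous_exp.continuousAt.comp
        (continuousAt_const.mul ((Real.continuous_cos.continuousAt).log ht))
    exact h.eventually_lt_const (lt_add_one _)
  have hs := (hcos.and (htan.and (hsec.and hexp)))
  have hD1 : Integrable fun x : ℝ => wave l (t, x) * f x :=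
    integrable_mul_of_le (continuous_wave_snd l t)
      (C := Real.exp (-(1 / 2) * Real.log (Real.cos t))) (fun x => by
        rw [norm_wave]
        exact le_mul_of_one_le_right (Real.exp_pos _).le (by linarith [sq_nonneg x])) f
  have key := hasDerivAt_integral_of_dominated_loc_of_deriv_le (μ := MeasureTheory.volume)
    (F := fun s x => wave l (s, x) * f x)
    (F' := fun s x => 1 / (2 * Complex.I) * oscOp (wave l) (s, x) * f x)
    (bound := fun x => (1 / 2) * (D * (2 * B ^ 2 * (1 + l ^ 2) + B + 1)) * ((1 + x ^ 2) * ‖f x‖))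
    hs
    (Eventually.of_forall fun s =>
      ((continuous_wave_snd l s).mul f.continuous).aestronglyMeasurable)
    hD1
    ((continuous_const.mul (continuous_oscOp_wave l t)).mul f.continuous).aestronglyMeasurable
    (Eventually.of_forall fun x s hs => by
      have h := norm_oscOp_wave_le (l := l) hs.2.1.le hs.2.2.1.le hs.2.2.2.le x
      have h2 : ‖(1 / (2 * Complex.I) : ℂ)‖ = 1 / 2 := by simp
      simp only [norm_mul, h2]
      calc 1 / 2 * ‖oscOp (wave l) (s, x)‖ * ‖f x‖
          ≤ 1 / 2 * (D * (2 * B ^ 2 * (1 + l ^ 2) + B + 1) * (1 + x ^ 2)) * ‖f x‖ := by gcongr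
        _ = _ := by ring)
    ((integrable_weight_mul f).const_mul _)
    (Eventually.of_forall fun x s hs => (hasDerivAt_wave_fst l hs.1 x).mul_const (f x))
  have h1 := key.2
  simp only [mul_assoc] at h1
  rw [MeasureTheory.integral_const_mul, integral_oscOp_wave_mul,
    ← evolution_apply_of_cos_ne_zero l ht] at h1
  refine (h1.congr_of_eventuallyEq ?_).congr_deriv ?_
  · filter_upwards [hcos] with s hs
    exact evolution_apply_of_cos_ne_zero l hs f
  · field_simp
    rw [Complex.I_sq]
    ring

/-- A function with a derivative at the points near `a` other than `a`, which is continuous at `a`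
together with this derivative, is differentiable at `a`. -/
lemma hasDerivAt_of_eventually_hasDerivAt {E : Type*} [NormedAddCommGroup E] [NormedSpace ℝ E]
    {f g : ℝ → E} {a : ℝ} (hd : ∀ᶠ y in 𝓝[≠] a, HasDerivAt f (g y) y)
    (hf : ContinuousAt f a) (hg : ContinuousAt g a) : HasDerivAt f (g a) a := by
  set s : Set ℝ := {y | HasDerivAt f (g y) y} with hs
  have hdiff : DifferentiableOn ℝ f s := fun y hy => hy.differentiableAt.differentiableWithinAt
  have hr : s ∈ 𝓝[>] a := nhdsWithin_mono a (fun y hy => ne_of_gt hy) hd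
  have hl : s ∈ 𝓝[<] a := nhdsWithin_mono a (fun y hy => ne_of_lt hy) hd
  have A : HasDerivWithinAt f (g a) (Set.Ici a) a := by
    refine hasDerivWithinAt_Ici_of_tendsto_deriv hdiff hf.continuousWithinAt hr ?_
    refine (hg.tendsto.mono_left nhdsWithin_le_nhds).congr' ?_
    filter_upwards [hr] with y hy using hy.deriv.symm
  have B : HasDerivWithinAt f (g a) (Set.Iic a) a := by
    refine hasDerivWithinAt_Iic_of_tendsto_deriv hdiff hf.continuousWithinAt hl ?_
    refine (hg.tendsto.mono_left nhdsWithin_le_nhds).congr' ?_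
    filter_upwards [hl] with y hy using hy.deriv.symm
  simpa using B.union A

lemma eventually_cos_ne_zero (t : ℝ) : ∀ᶠ s in 𝓝[≠] t, Real.cos s ≠ 0 := by
  by_cases ht : Real.cos t = 0
  · have h := (Real.hasDerivAt_cos t).eventually_ne (c := 0) (by
      have := sin_sq_eq_one_of_cos_eq_zero ht
      rw [neg_ne_zero]
      rintro h
      simp [h] at this)
    exact h
  · exact (Real.continuous_cos.continuousAt.eventually_ne ht).filter_mono nhdsWithin_le_nhds

lemma continuousAt_evolution (l : ℝ) (f : 𝓢(ℝ, ℂ)) (t : ℝ) :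
    ContinuousAt (fun s => evolution l s f) t := by
  by_cases ht : Real.cos t = 0
  · exact continuousAt_evolution_of_cos_eq_zero l f ht
  · exact (hasDerivAt_evolution_of_cos_ne_zero l f ht).continuousAt

/-- The equation holds at the caustics as well, where the derivative extends continuously. -/
lemma hasDerivAt_evolution (l : ℝ) (f : 𝓢(ℝ, ℂ)) (t : ℝ) :
    HasDerivAt (fun s => evolution l s f)
      (-Complex.I * evolution l t (schwartzHamiltonian f)) t := by
  refine hasDerivAt_of_eventually_hasDerivAt
    (g := fun s => -Complex.I * evolution l s (schwartzHamiltonian f)) ?_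
    (continuousAt_evolution l f t) ((continuousAt_evolution l _ t).const_mul _)
  filter_upwards [eventually_cos_ne_zero t] with s hs
  exact hasDerivAt_evolution_of_cos_ne_zero l f hs

lemma wave_zero (l x : ℝ) : wave l (0, x) = character l x := by
  have hm : maslovIndex 0 = 0 := by
    rw [maslovIndex_eq_iff]
    have := Real.pi_pos
    constructor <;> simp <;> linarith
  simp [wave, wavePhase, character, hm]

/-- The evolved states solve the Cauchy problem for the datum `e^{iλx}`. -/
lemma solvesCauchyProblem_evolution (l : ℝ) :
    SolvesCauchyProblem (character l) (evolution l) := by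
  refine ⟨fun f => ?_, fun f t _ => ⟨-Complex.I * evolution l t (schwartzHamiltonian f),
    (hasDerivAt_evolution l f t).hasDerivWithinAt, ?_⟩⟩
  · rw [evolution_apply_of_cos_ne_zero l (by simp)]
    simp only [wave_zero]
  · rw [hamiltonian_apply]
    linear_combination -(evolution l t (schwartzHamiltonian f)) * Complex.I_mul_I

/-! ### Local integrability of the wave -/

lemma intervalIntegrable_exp_log_cos (a b : ℝ) :
    IntervalIntegrable (fun t => Real.exp (-(1 / 2) * Real.log (Real.cos t)))
      MeasureTheory.volume a b := by
  set h : ℝ → ℝ := fun s => Real.exp (-(1 / 2) * Real.log (Real.sin s)) with hh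
  have hpi := Real.pi_pos
  have hmeas : Measurable h :=
    Real.measurable_exp.comp ((Real.measurable_log.comp Real.measurable_sin).const_mul _)
  -- Jordan's inequality `2 s / π ≤ sin s` bounds the singularity by `s ^ (-1/2)`
  have h1 : IntervalIntegrable h MeasureTheory.volume 0 (Real.pi / 2) := by
    have hr : IntervalIntegrable (fun s : ℝ => (2 / Real.pi) ^ (-(1 / 2) : ℝ) *
        s ^ (-(1 / 2) : ℝ)) MeasureTheory.volume 0 (Real.pi / 2) :=
      (intervalIntegral.intervalIntegrable_rpow' (by norm_num)).const_mul _
    refine hr.mono_fun hmeas.aestronglyMeasurable ?_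
    refine (MeasureTheory.ae_restrict_iff' measurableSet_uIoc).2 (Eventually.of_forall ?_)
    intro s hs
    rw [Set.uIoc_of_le (by positivity)] at hs
    have hc : 0 < 2 / Real.pi * s := mul_pos (by positivity) hs.1
    have hsin : 2 / Real.pi * s ≤ Real.sin s := Real.mul_le_sin hs.1.le hs.2
    simp only [hh]
    rw [← Real.mul_rpow (by positivity) hs.1.le, Real.norm_of_nonneg (Real.exp_nonneg _),
      Real.norm_of_nonneg (Real.rpow_nonneg hc.le _), Real.rpow_def_of_pos hc, Real.exp_le_exp]
    have := Real.log_le_log hc hsin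
    linarith
  have h2 : IntervalIntegrable h MeasureTheory.volume (Real.pi / 2) Real.pi := by
    have := (h1.comp_sub_left Real.pi).symm
    simpa only [hh, sub_zero, sub_half, Real.sin_pi_sub] using this
  have hper : Function.Periodic h Real.pi := fun s => by
    simp only [hh, Real.sin_add_pi, Real.log_neg_eq_log]
  have h3 : IntervalIntegrable h MeasureTheory.volume 0 Real.pi := h1.trans h2
  have h4 := (hper.intervalIntegrable₀ hpi.ne' h3 (a + Real.pi / 2)
    (b + Real.pi / 2)).comp_add_right (Real.pi / 2)
  simpa only [hh, add_sub_cancel_right, Real.sin_add_pi_div_two] using h4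

lemma measurable_wave (l : ℂ) : Measurable (wave l) := by
  have hm : Measurable maslovIndex := ((measurable_id.div_const _).add_const _).floor
  have hm' : Measurable fun p : ℝ × ℝ => ((maslovIndex p.1 : ℤ) : ℂ) :=
    (measurable_from_top (f := fun n : ℤ => (n : ℂ))).comp (hm.comp measurable_fst)
  have hcos : Measurable fun p : ℝ × ℝ => Real.cos p.1 := Real.measurable_cos.comp measurable_fst
  have htan : Measurable fun p : ℝ × ℝ => Real.tan p.1 := by
    simp only [Real.tan_eq_sin_div_cos]
    exact (Real.measurable_sin.comp measurable_fst).div hcos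
  have hx : Measurable fun p : ℝ × ℝ => (p.2 : ℂ) := Complex.measurable_ofReal.comp measurable_snd
  refine Complex.measurable_exp.comp ((((Complex.measurable_ofReal.comp
    ((Real.measurable_log.comp hcos).const_mul _)).add (hm'.const_mul _)).add
    ((((hx.pow_const 2).add_const _).const_mul _).mul
      (Complex.measurable_ofReal.comp htan))).add
    ((hx.const_mul _).mul (Complex.measurable_ofReal.comp hcos.inv)))

/-- The wave is locally integrable across the caustics, its modulus being `|cos t| ^ (-1/2)`. -/
lemma locallyIntegrable_wave (l : ℝ) : MeasureTheory.LocallyIntegrable (wave l) := by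
  rw [MeasureTheory.locallyIntegrable_iff]
  intro K hK
  obtain ⟨R, hR⟩ := hK.isBounded.subset_closedBall 0
  have hsub : K ⊆ Set.uIoc (-R - 1) (R + 1) ×ˢ Set.Icc (-R) R := by
    intro p hp
    have h := hR hp
    rw [mem_closedBall_zero_iff, Prod.norm_def, max_le_iff, Real.norm_eq_abs, Real.norm_eq_abs,
      abs_le, abs_le] at h
    rw [Set.uIoc_of_le (by linarith [h.1.1, h.1.2])]
    exact ⟨⟨by linarith [h.1.1], by linarith [h.1.2]⟩, h.2⟩
  refine MeasureTheory.IntegrableOn.mono_set ?_ hsub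
  have h := (intervalIntegrable_exp_log_cos (-R - 1) (R + 1)).def'
  have h' := MeasureTheory.Integrable.comp_fst h
    ((MeasureTheory.volume : MeasureTheory.Measure ℝ).restrict (Set.Icc (-R) R))
  rw [MeasureTheory.Measure.prod_restrict] at h'
  refine h'.mono' (measurable_wave l).aestronglyMeasurable (Eventually.of_forall fun p => ?_)
  exact (norm_wave l p.1 p.2).le

/-! ### The distribution defined by the wave -/

/-- The distribution on `]0,∞[ × ℝ` given by the locally integrable function `wave l`. -/
def waveDistribution (l : ℝ) : 𝓓'(phaseSpace, ℂ) :=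
  let T : 𝓓(phaseSpace, ℝ) →L[ℝ] ℂ := TestFunction.integralAgainstBilinCLM
    (ContinuousLinearMap.lsmul ℝ ℝ) MeasureTheory.volume (wave l)
  { toFun := T
    map_add' := T.map_add
    map_smul' := T.map_smul
    cont := T.cont }

lemma waveDistribution_apply (l : ℝ) (θ : 𝓓(phaseSpace, ℝ)) :
    waveDistribution l θ = ∫ p : ℝ × ℝ, (θ p : ℂ) * wave l p := by
  have h : waveDistribution l θ = ∫ p : ℝ × ℝ, ContinuousLinearMap.lsmul ℝ ℝ (θ p) (wave l p) :=
    TestFunction.integralAgainstBilinCLM_eq_integral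
      ((locallyIntegrable_wave l).locallyIntegrableOn _)
  simpa only [ContinuousLinearMap.lsmul_apply, Complex.real_smul] using h

lemma integrable_testFunction_mul {Ω : TopologicalSpace.Opens (ℝ × ℝ)} {g : ℝ × ℝ → ℂ}
    (hg : MeasureTheory.LocallyIntegrableOn g Ω) (θ : 𝓓(Ω, ℝ)) :
    Integrable fun p : ℝ × ℝ => (θ p : ℂ) * g p := by
  have h := TestFunction.integrable_bilin (ContinuousLinearMap.lsmul ℝ ℝ) hg θ
  simpa only [ContinuousLinearMap.lsmul_apply, Complex.real_smul] using h

lemma ae_cos_ne_zero : ∀ᵐ t : ℝ, Real.cos t ≠ 0 := by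
  have hc : {t : ℝ | Real.cos t = 0}.Countable := by
    refine (Set.countable_range fun k : ℤ => (2 * (k : ℝ) + 1) * Real.pi / 2).mono ?_
    intro t ht
    obtain ⟨k, hk⟩ := Real.cos_eq_zero_iff.1 ht
    exact ⟨k, hk.symm⟩
  exact hc.ae_notMem _

/-- Pairing the evolved states with the time slices of a test function is Fubini's theorem, since
the caustics form a null set. -/
theorem evolvesTo_waveDistribution (l : ℝ) : EvolvesTo (character l) (waveDistribution l) := by
  refine ⟨evolution l, solvesCauchyProblem_evolution l, fun θ => ?_⟩
  have hi : Integrable fun p : ℝ × ℝ => (θ p : ℂ) * wave l p :=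
    integrable_testFunction_mul ((locallyIntegrable_wave l).locallyIntegrableOn _) θ
  have hae : (fun t => ∫ x, (θ (t, x) : ℂ) * wave l (t, x)) =ᵐ[MeasureTheory.volume]
      fun t => evolution l t (timeSlice θ t) := by
    filter_upwards [ae_cos_ne_zero] with t ht
    rw [evolution_apply_of_cos_ne_zero l ht]
    congr 1
    funext x
    rw [mul_comm]
    rfl
  have hint := hi.integral_prod_left.congr hae
  refine ⟨hint.integrableOn, ?_⟩
  rw [waveDistribution_apply, MeasureTheory.Measure.volume_eq_prod,
    MeasureTheory.integral_prod _ hi, MeasureTheory.integral_congr_ae hae,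
    MeasureTheory.setIntegral_eq_integral_of_forall_compl_eq_zero]
  intro t ht
  have hz : timeSlice θ t = 0 := by
    ext x
    have hx : θ (t, x) = 0 := by
      by_contra h
      exact ht (θ.tsupport_subset (subset_tsupport _ h))
    exact congrArg Complex.ofReal hx
  rw [hz, map_zero]

lemma isGivenOnBy_waveDistribution (l : ℝ) (V : Set (ℝ × ℝ)) :
    IsGivenOnBy (waveDistribution l) V (wave l) :=
  fun θ _ => waveDistribution_apply l θ

/-! ### The singular support -/

/-- A function that represents a distribution is determined wherever it is continuous. -/
lemma IsGivenOnBy.eqOn {Ω : TopologicalSpace.Opens (ℝ × ℝ)} {φ : 𝓓'(Ω, ℂ)} {V W : Set (ℝ × ℝ)}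
    {f g : ℝ × ℝ → ℂ} (hf : IsGivenOnBy φ V f) (hg : IsGivenOnBy φ V g) (hW : IsOpen W)
    (hWV : W ⊆ V) (hWΩ : W ⊆ Ω) (hfc : ContinuousOn f W) (hgc : ContinuousOn g W) :
    Set.EqOn f g W := by
  have hfi := hfc.locallyIntegrableOn (μ := MeasureTheory.volume) hW.measurableSet
  have hgi := hgc.locallyIntegrableOn (μ := MeasureTheory.volume) hW.measurableSet
  have hae := hW.ae_eq_zero_of_integral_contDiff_smul_eq_zero (hfi.sub hgi) (by
    intro θ hθ hθc hθW
    let θΩ : 𝓓(Ω, ℝ) := ⟨θ, hθ, hθc, hθW.trans hWΩ⟩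
    let θW : 𝓓((⟨W, hW⟩ : TopologicalSpace.Opens (ℝ × ℝ)), ℝ) := ⟨θ, hθ, hθc, hθW⟩
    have h1 : Integrable fun p : ℝ × ℝ => (θ p : ℂ) * f p := integrable_testFunction_mul hfi θW
    have h2 : Integrable fun p : ℝ × ℝ => (θ p : ℂ) * g p := integrable_testFunction_mul hgi θW
    have h3 : ∫ p, (θ p : ℂ) * f p = ∫ p, (θ p : ℂ) * g p :=
      (hf θΩ (hθW.trans hWV)).symm.trans (hg θΩ (hθW.trans hWV))
    rw [← sub_eq_zero, ← MeasureTheory.integral_sub h1 h2] at h3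
    rw [← h3]
    congr 1
    funext p
    rw [Pi.sub_apply, Complex.real_smul, mul_sub])
  refine MeasureTheory.Measure.eqOn_open_of_ae_eq (μ := MeasureTheory.volume) ?_ hW hfc hgc
  refine (MeasureTheory.ae_restrict_iff' hW.measurableSet).2 ?_
  filter_upwards [hae] with p hp hpW using sub_eq_zero.1 (hp hpW)

lemma tendsto_norm_wave_atTop (l x : ℝ) {t : ℝ} (ht : Real.cos t = 0) :
    Tendsto (fun s => ‖wave l (s, x)‖) (𝓝[≠] t) atTop := by
  simp only [norm_wave]
  refine Real.tendsto_exp_atTop.comp ?_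
  refine Tendsto.const_mul_atBot_of_neg (by norm_num) (Real.tendsto_log_nhdsNE_zero.comp ?_)
  refine tendsto_nhdsWithin_iff.2 ⟨?_, eventually_cos_ne_zero t⟩
  rw [← ht]
  exact Real.continuous_cos.continuousAt.tendsto.mono_left nhdsWithin_le_nhds

/-- The caustics are singular because the wave is unbounded there. -/
theorem singularSupport_waveDistribution (l : ℝ) :
    singularSupport (waveDistribution l) = singularLines := by
  ext p
  constructor
  · rintro ⟨hp, hns⟩
    by_contra h
    exact hns ⟨regularRegion, isOpen_regularRegion, ⟨hp, h⟩, Set.sdiff_subset, wave l,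
      contDiffOn_wave l, isGivenOnBy_waveDistribution l _⟩
  · intro hp
    have hpos : 0 < p.1 := by
      obtain ⟨k, hk⟩ := hp
      rw [hk]
      positivity
    have hcos : Real.cos p.1 = 0 := by
      by_contra h
      exact (mem_regularRegion_iff.2 ⟨hpos, h⟩).2 hp
    refine ⟨hpos, ?_⟩
    rintro ⟨V, hV, hpV, hVΩ, g, hg, hgiven⟩
    have heq : Set.EqOn g (wave l) (V ∩ regularRegion) :=
      hgiven.eqOn (isGivenOnBy_waveDistribution l V) (hV.inter isOpen_regularRegion)
        Set.inter_subset_left (Set.inter_subset_left.trans hVΩ)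
        (hg.continuousOn.mono Set.inter_subset_left)
        ((contDiffOn_wave l).continuousOn.mono Set.inter_subset_right)
    have hslice : ContinuousAt (fun s : ℝ => (s, p.2)) p.1 := by fun_prop
    have hgp : ContinuousAt g ((fun s : ℝ => (s, p.2)) p.1) :=
      hg.continuousOn.continuousAt (hV.mem_nhds hpV)
    have hlim : Tendsto (fun s => ‖g (s, p.2)‖) (𝓝[≠] p.1) (𝓝 ‖g p‖) :=
      (ContinuousAt.comp (f := fun s : ℝ => (s, p.2)) hgp hslice).norm.tendsto.mono_left
        nhdsWithin_le_nhds
    refine not_tendsto_nhds_of_tendsto_atTop ?_ _ hlim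
    refine (tendsto_norm_wave_atTop l p.2 hcos).congr' ?_
    have hmem : ∀ᶠ s in 𝓝[≠] p.1, (s, p.2) ∈ V :=
      (hslice.eventually (hV.mem_nhds hpV)).filter_mono nhdsWithin_le_nhds
    have hpos' : ∀ᶠ s in 𝓝[≠] p.1, 0 < s :=
      (lt_mem_nhds hpos).filter_mono nhdsWithin_le_nhds
    filter_upwards [hmem, hpos', eventually_cos_ne_zero p.1] with s h1 h2 h3
    rw [heq ⟨h1, mem_regularRegion_iff.2 ⟨h2, h3⟩⟩]

end OscillatorSupershift

end

theorem mainTheorem2 :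
    -- each character evolves to exactly one distribution
    (∀ lam : ℝ, ∃! φ : 𝓓'(OscillatorSupershift.phaseSpace, ℂ),
      OscillatorSupershift.EvolvesTo (OscillatorSupershift.character lam) φ) ∧
    ∀ φ : ℝ → 𝓓'(OscillatorSupershift.phaseSpace, ℂ),
      (∀ lam : ℝ, OscillatorSupershift.EvolvesTo (OscillatorSupershift.character lam) (φ lam)) →
      (∀ lam : ℝ, OscillatorSupershift.singularSupport (φ lam) =
        {p : ℝ × ℝ | ∃ k : ℕ, p.1 = Real.pi * (2 * (k : ℝ) + 1) / 2}) ∧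
      -- the restrictions to the regular region are the smooth functions `Φ lam`
      ∃ Φ : ℝ → ℝ × ℝ → ℂ,
        (∀ lam : ℝ,
          ContDiffOn ℝ ∞ (Φ lam) OscillatorSupershift.regularRegion ∧
          OscillatorSupershift.IsGivenOnBy (φ lam) OscillatorSupershift.regularRegion (Φ lam)) ∧
        ∀ a : ℝ, a ∉ Set.Icc (-1 : ℝ) 1 →
          OscillatorSupershift.IsSupershift
            (fun (lam : ℝ) (τ : OscillatorSupershift.regularRegion) => Φ lam τ)
            (fun (N : ℕ) (τ : OscillatorSupershift.regularRegion) =>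
              OscillatorSupershift.shiftSeq Φ a N τ)
            Set.univ ∧
          ∀ μ ν : ℕ,
            -- the derivatives of the sequence and of its limit
            (∀ p ∈ OscillatorSupershift.regularRegion,
              (∀ N : ℕ, 1 ≤ N →
                OscillatorSupershift.dt^[μ] (OscillatorSupershift.dx^[ν]
                    (OscillatorSupershift.shiftSeq Φ a N)) p =
                  1 / (2 * Complex.I) ^ μ * OscillatorSupershift.dx^[ν]
                    (OscillatorSupershift.oscOp^[μ]
                      (OscillatorSupershift.shiftSeq Φ a N)) p) ∧
              OscillatorSupershift.dt^[μ] (OscillatorSupershift.dx^[ν] (Φ a)) p =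
                1 / (2 * Complex.I) ^ μ * OscillatorSupershift.dx^[ν]
                  (OscillatorSupershift.oscOp^[μ] (Φ a)) p) ∧
            ∀ K : Set (ℝ × ℝ), IsCompact K → K ⊆ OscillatorSupershift.regularRegion →
              TendstoUniformlyOn
                (fun N : ℕ => OscillatorSupershift.dt^[μ] (OscillatorSupershift.dx^[ν]
                  (OscillatorSupershift.shiftSeq Φ a N)))
                (OscillatorSupershift.dt^[μ] (OscillatorSupershift.dx^[ν] (Φ a)))
                Filter.atTop K ∧
              -- the same with the differential operators in `x` composed in the other order
              TendstoUniformlyOn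
                (fun (N : ℕ) (p : ℝ × ℝ) => 1 / (2 * Complex.I) ^ μ *
                  OscillatorSupershift.oscOp^[μ] (OscillatorSupershift.dx^[ν]
                    (OscillatorSupershift.shiftSeq Φ a N)) p)
                (fun p : ℝ × ℝ => 1 / (2 * Complex.I) ^ μ *
                  OscillatorSupershift.oscOp^[μ] (OscillatorSupershift.dx^[ν] (Φ a)) p)
                Filter.atTop K := by
  refine ⟨fun l => ⟨_, OscillatorSupershift.evolvesTo_waveDistribution l,
    fun φ hφ => hφ.unique (OscillatorSupershift.evolvesTo_waveDistribution l)⟩, fun φ hφ => ?_⟩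
  obtain rfl : φ = OscillatorSupershift.waveDistribution := funext fun l =>
    (hφ l).unique (OscillatorSupershift.evolvesTo_waveDistribution l)
  refine ⟨OscillatorSupershift.singularSupport_waveDistribution,
    fun l => OscillatorSupershift.wave l,
    fun l => ⟨OscillatorSupershift.contDiffOn_wave l,
      OscillatorSupershift.isGivenOnBy_waveDistribution l _⟩,
    fun a ha => ⟨OscillatorSupershift.isSupershift_wave ha, fun μ ν =>
      ⟨fun p hp => ⟨fun N _ => OscillatorSupershift.dt_iterate_dx_iterate_eq
          (OscillatorSupershift.contDiffOn_shiftSeq_wave a N)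
          (OscillatorSupershift.dt_shiftSeq_wave_eq a N) μ ν hp,
        OscillatorSupershift.dt_iterate_dx_iterate_eq (OscillatorSupershift.contDiffOn_wave a)
          (OscillatorSupershift.dt_wave_eq a) μ ν hp⟩,
      fun K hK hKr => ⟨((OscillatorSupershift.isRegularOp_dt.iterate μ).comp
        (OscillatorSupershift.isRegularOp_dx.iterate ν)).tendstoUniformlyOn a hK hKr, ?_⟩⟩⟩⟩
  exact (uniformContinuous_mul_left' (1 / (2 * Complex.I) ^ μ)).comp_tendstoUniformlyOn
    (((OscillatorSupershift.isRegularOp_oscOp.iterate μ).comp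
      (OscillatorSupershift.isRegularOp_dx.iterate ν)).tendstoUniformlyOn a hK hKr)
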